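/- Let $n\ge 2$, $T>0$ and $\delta>0$. **Network.** Let $\mathcal D(t)$, $t\ge 0$, be a time-varying digraph on $\{1,\dots,n\}$ (measurable in $t$), where an edge $(i,j)$ means that node $i$ receives information from node $j$. Let $\mathcal A(t)$ be its $0/1$ adjacency matrix, $\mathcal N_i(t)=\{j:(i,j)\in\mathcal E(t)\}$, and $L(t)=\Delta(t)-\mathcal A(t)$ its Laplacian, with $\Delta$ diagonal and $\Delta_{ii}=\sum_{j\ne i}\mathcal A_{ij}$. Call $(i,j)$ a $\delta$-edge of $\int_t^{t+T}L(\tau)\,d\tau$ if $\int_t^{t+T}-L_{ij}(\tau)\,d\tau\ge\delta$. Assume that for every $t\ge 0$ the digraph represented by $\int_t^{t+T}L(\tau)\,d\tau$ contains a $\delta$-spanning tree: there is a root node (possibly depending on $t$) from which information reaches every other node along $\delta$-edges. **Coordination law.** Let $t_f>0$, let $p_{d,i}:[0,t_f]\to\mathbb R^3$ ($i=1,\dots,n$) be differentiable desired trajectories, let $\dot\gamma_d$ be a differentiable reference pace and let $p_i(t)\in\mathbb R^3$ be the actual positions. On a time interval $J\subseteq[0,\infty)$ containing $0$ (for instance $J=[0,\infty)$),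 let $\gamma_i:J\to[0,t_f]$ satisfy, in the sense of Carathéodory, $$\ddot\gamma_i=-b(\dot\gamma_i-\dot\gamma_d)-a\sum_{j\in\mathcal N_i(t)}(\gamma_i-\gamma_j)+\frac{\dot p_{d,i}(\gamma_i)^\top e_{PF,i}}{\|\dot p_{d,i}(\gamma_i)\|+\epsilon},\qquad e_{PF,i}(t)=p_i(t)-p_{d,i}(\gamma_i(t)),$$ with arbitrary initial data, where $\dot p_{d,i}$ is the derivative of $p_{d,i}$ with respect to its argument. Let $e_{PF}=(e_{PF,1},\dots,e_{PF,n})$. Let $Q\in\mathbb R^{(n-1)\times n}$ satisfy $Q1_n=0$ and $QQ^\top=\mathbb I_{n-1}$, and let $$\xi_{TC}(t)=\begin{bmatrix}Q\gamma(t)\\ \dot\gamma(t)-\dot\gamma_d(t)1_n\end{bmatrix}\in\mathbb R^{2n-1}.$$ All norms are Euclidean. **Constants.** For $a,b>0$ put $\delta'=\min\{1,\tfrac ab\delta\}\,e^{-(n-1)\frac ab T}$, $k=\dfrac1{1-(\delta')^n}$ and $\lambda=-\dfrac1{nT}\ln\bigl(1-(\delta')^n\bigr)$. **Theorem.** There exist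 gains $a,b,\epsilon>0$, depending only on $n,T,\delta$, such that for every rate $\lambda_{TC}$ with $$0<\lambda_{TC}\le\frac{\lambda}{6nk^2}$$ there are constants $\kappa_1,\kappa_2>0$, depending only on $n,T,\delta,\lambda_{TC}$ and the gains, such that for all networks, trajectories, positions, reference paces, matrices $Q$, intervals $J$ and solutions as above, $$\|\xi_{TC}(t)\|\le\kappa_1\|\xi_{TC}(0)\|e^{-\lambda_{TC}t}+\kappa_2\sup_{s\in J}\bigl(\|e_{PF}(s)\|+|\ddot\gamma_d(s)|\bigr)\qquad\text{for all }t\in J$$ (the supremum may be $+\infty$, in which case the bound is trivial). -/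

import Mathlib

open Set MeasureTheory
open scoped Matrix ENNReal

noncomputable section

namespace TimeCoordination

/-! ### Time-varying digraphs.  `D.Adj i j` is the edge `(i, j)`: node `i` receives from node `j`. -/

open Classical in
/-- Adjacency matrix: entry `1` on edges, `0` elsewhere. -/
def adjMatrix {n : ℕ} (D : Digraph (Fin n)) : Matrix (Fin n) (Fin n) ℝ :=
  fun i j => if D.Adj i j then 1 else 0

/-- Laplacian `L = Δ - A`, where `Δ` is diagonal with `Δ_ii = ∑_{j ≠ i} A_ij`. -/
def laplacian {n : ℕ} (D : Digraph (Fin n)) : Matrix (Fin n) (Fin n) ℝ :=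
  Matrix.diagonal (fun i => ∑ j ∈ Finset.univ.erase i, adjMatrix D i j) - adjMatrix D

open Classical in
/-- Neighborhood `N_i` of node `i`: the nodes from which `i` receives information. -/
def neighborhood {n : ℕ} (D : Digraph (Fin n)) (i : Fin n) : Finset (Fin n) :=
  Finset.univ.filter (fun j => D.Adj i j)

/-- `(i, j)` is a `δ`-edge of the digraph represented by `∫_t^{t+T} L(τ) dτ`. -/
def IsDeltaEdge {n : ℕ} (D : ℝ → Digraph (Fin n)) (t T δ : ℝ) (i j : Fin n) : Prop :=
  δ ≤ ∫ τ in t..(t + T), -(laplacian (D τ) i j)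

/-- The digraph represented by `∫_t^{t+T} L(τ) dτ` contains a `δ`-spanning tree: some root `r`
reaches every other node along `δ`-edges (information travels from `v` to `u` along `(u, v)`). -/
def HasDeltaSpanningTree {n : ℕ} (D : ℝ → Digraph (Fin n)) (t T δ : ℝ) : Prop :=
  ∃ r : Fin n, ∀ i : Fin n,
    Relation.ReflTransGen (fun v u => IsDeltaEdge D t T δ u v) r i

/-- The switching of the digraph is measurable in time: every edge is active on a measurable set
of times. -/
def MeasurableDigraph {n : ℕ} (D : ℝ → Digraph (Fin n)) : Prop :=
  ∀ i j : Fin n, MeasurableSet {t : ℝ | (D t).Adj i j}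

/-! ### Path following and the coordination law -/

/-- Path-following error `e_i(t) = p_i(t) - p_{d,i}(γ_i(t))`, stacked over `i`; the norm is
Euclidean. -/
def pathError {n : ℕ} (pd p : Fin n → ℝ → EuclideanSpace ℝ (Fin 3)) (γ : ℝ → Fin n → ℝ) (t : ℝ) :
    PiLp 2 (fun _ : Fin n => EuclideanSpace ℝ (Fin 3)) :=
  WithLp.toLp 2 (fun i => p i t - pd i (γ t i))

/-- Derivative of the desired trajectory `p_{d,i} : [0, t_f] → ℝ³` at the parameter `s`
(one-sided at the end points). -/
def desiredVelocity {n : ℕ} (tf : ℝ) (pd : Fin n → ℝ → EuclideanSpace ℝ (Fin 3)) (i : Fin n)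
    (s : ℝ) : EuclideanSpace ℝ (Fin 3) :=
  derivWithin (pd i) (Icc 0 tf) s

/-- Feedback `⟨ṗ_{d,i}(γ_i), e_i⟩ / (‖ṗ_{d,i}(γ_i)‖ + ε)` of the path-following error. -/
def alphaBar {n : ℕ} (ε tf : ℝ) (pd p : Fin n → ℝ → EuclideanSpace ℝ (Fin 3))
    (γ : ℝ → Fin n → ℝ) (i : Fin n) (t : ℝ) : ℝ :=
  inner ℝ (desiredVelocity tf pd i (γ t i)) (pathError pd p γ t i) /
    (‖desiredVelocity tf pd i (γ t i)‖ + ε)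

/-- Right-hand side of the second-order coordination law for agent `i`; `γ'` is the rate of `γ`
and `w` is the desired mission pace. -/
def coordinationLaw {n : ℕ} (a b ε tf : ℝ) (D : ℝ → Digraph (Fin n))
    (pd p : Fin n → ℝ → EuclideanSpace ℝ (Fin 3)) (w : ℝ → ℝ) (γ γ' : ℝ → Fin n → ℝ)
    (i : Fin n) (t : ℝ) : ℝ :=
  -b * (γ' t i - w t) - a * ∑ j ∈ neighborhood (D t) i, (γ t i - γ t j)
    + alphaBar ε tf pd p γ i t

/-- `γ` evolves on the time interval `J` (which starts at `0`) by the coordination law, with rate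
`γ'` and values in `[0, t_f]`.  The right-hand side jumps when the digraph switches, so the law is
understood in the sense of Carathéodory: `γ` is differentiable with derivative `γ'`, and `γ'` is
the integral of the right-hand side. -/
structure IsCoordinationSolution {n : ℕ} (a b ε tf : ℝ) (D : ℝ → Digraph (Fin n))
    (pd p : Fin n → ℝ → EuclideanSpace ℝ (Fin 3)) (w : ℝ → ℝ) (J : Set ℝ)
    (γ γ' : ℝ → Fin n → ℝ) : Prop where
  mem_range : ∀ t ∈ J, ∀ i, γ t i ∈ Icc 0 tf
  hasDeriv : ∀ t ∈ J, ∀ i, HasDerivWithinAt (fun s => γ s i) (γ' t i) J t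
  integrable : ∀ t ∈ J, ∀ i,
    IntervalIntegrable (coordinationLaw a b ε tf D pd p w γ γ' i) volume 0 t
  rate_eq : ∀ t ∈ J, ∀ i,
    γ' t i = γ' 0 i + ∫ s in (0 : ℝ)..t, coordinationLaw a b ε tf D pd p w γ γ' i s

/-- Coordination error `ξ_TC = [Qγ; γ' - w·1] ∈ ℝ^{(n-1)+n}`, with the Euclidean norm. -/
def coordinationError {n : ℕ} (Q : Matrix (Fin (n - 1)) (Fin n) ℝ) (w : ℝ → ℝ)
    (γ γ' : ℝ → Fin n → ℝ) (t : ℝ) : EuclideanSpace ℝ (Fin (n - 1) ⊕ Fin n) :=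
  WithLp.toLp 2 (Sum.elim (Q *ᵥ γ t) (fun i => γ' t i - w t))

/-! ### The constants of the consensus rate -/

/-- `δ' = min {1, (a/b) δ} · exp (-(n-1) (a/b) T)`. -/
def deltaPrime (n : ℕ) (a b T δ : ℝ) : ℝ :=
  min 1 (a / b * δ) * Real.exp (-((n : ℝ) - 1) * (a / b) * T)

/-- `k = 1 / (1 - δ'^n)`. -/
def consensusGain (n : ℕ) (a b T δ : ℝ) : ℝ :=
  1 / (1 - deltaPrime n a b T δ ^ n)

/-- `λ = -(1/(nT)) ln (1 - δ'^n)`. -/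
def consensusRate (n : ℕ) (a b T δ : ℝ) : ℝ :=
  -(1 / (n * T)) * Real.log (1 - deltaPrime n a b T δ ^ n)

end TimeCoordination

end

/-! Take equal gains `a = b`, large. Then `a / b = 1`, so `δ'` and the admissible rates no longer
depend on `b`, and `b` can be fixed before the rate.

With `y_i = γ_i + γ'_i / b` and `z_i = γ'_i - w`, the law becomes a consensus system for `y` with
common drift `w` and a disturbance of size `O((|z| + |e_PF|) / b)`, together with a scalar equation
`z' = -b z + …` whose forcing is `b n` times the diameter of `y` plus terms independent of the
factor `b`. Thus `z` is bounded by the diameter of `y` up to constants, while its feedback into `y`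
carries a factor `1 / b`: a small-gain loop (`small_gain`).

The diameter of `y` contracts as follows (`diam_contraction`). The distances of `y_i` to the
drifting maximum and minimum are nonnegative supersolutions `U`, `L` of the consensus dynamics. At
level `v`, half the diameter, every node lies in `{U ≥ v}` or in `{L ≥ v}`. In each window of length
`T` the root lies in one of these sets; unless that set is everything, an edge leaves it and it
gains a node, at the price of lowering the level by a factor `d = δ'` (`consensus_superlevel`).
After `n - 1` windows the cardinalities add up to at least `2n - 1`, so one set is everything, and
the diameter has lost a fraction `η = d ^ (n - 1) / 2`.

All quantities are compared with the profile `E τ = 4 N exp(-μ τ) + S`, where `N` bounds the initial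
error and `S` the input. The bound on the rate `μ` ensures that `E` varies by a factor at most `1 +
η / 2` over `n - 1` windows, less than the contraction gains. -/

namespace TimeCoordination

/-! ### Absolutely continuous functions with a prescribed derivative -/

/-- `f` is absolutely continuous on `[s, t]` with derivative `h` almost everywhere. -/
structure HasAEDerivOn (f h : ℝ → ℝ) (s t : ℝ) : Prop where
  ac : AbsolutelyContinuousOnInterval f s t
  deriv : ∀ᵐ x, x ∈ uIcc s t → HasDerivAt f (h x) x

namespace HasAEDerivOn

variable {f g h k : ℝ → ℝ} {s t : ℝ}

theorem continuousOn (hf : HasAEDerivOn f h s t) (hst : s ≤ t) : ContinuousOn f (Icc s t) := by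
  simpa [uIcc_of_le hst] using hf.ac.continuousOn

theorem mono {s' t' : ℝ} (hf : HasAEDerivOn f h s t) (hs : s ≤ s') (hst : s' ≤ t') (ht : t' ≤ t) :
    HasAEDerivOn f h s' t' := by
  have hsub : uIcc s' t' ⊆ uIcc s t := by
    rw [uIcc_of_le hst, uIcc_of_le (hs.trans (hst.trans ht))]
    exact Icc_subset_Icc hs ht
  refine ⟨hf.ac.mono hsub, ?_⟩
  filter_upwards [hf.deriv] with x hx hx'
  exact hx (hsub hx')

theorem add (hf : HasAEDerivOn f h s t) (hg : HasAEDerivOn g k s t) :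
    HasAEDerivOn (fun x => f x + g x) (fun x => h x + k x) s t := by
  refine ⟨hf.ac.add hg.ac, ?_⟩
  filter_upwards [hf.deriv, hg.deriv] with x h1 h2 hx
  exact (h1 hx).add (h2 hx)

theorem sub (hf : HasAEDerivOn f h s t) (hg : HasAEDerivOn g k s t) :
    HasAEDerivOn (fun x => f x - g x) (fun x => h x - k x) s t := by
  refine ⟨hf.ac.sub hg.ac, ?_⟩
  filter_upwards [hf.deriv, hg.deriv] with x h1 h2 hx
  exact (h1 hx).sub (h2 hx)

theorem mul (hf : HasAEDerivOn f h s t) (hg : HasAEDerivOn g k s t) :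
    HasAEDerivOn (fun x => f x * g x) (fun x => h x * g x + f x * k x) s t := by
  refine ⟨hf.ac.fun_mul hg.ac, ?_⟩
  filter_upwards [hf.deriv, hg.deriv] with x h1 h2 hx
  exact (h1 hx).mul (h2 hx)

theorem of_contDiff (hf : ContDiff ℝ 1 f) (s t : ℝ) : HasAEDerivOn f (_root_.deriv f) s t :=
  ⟨hf.contDiffOn.absolutelyContinuousOnInterval,
    ae_of_all _ fun x _ => (hf.differentiable one_ne_zero x).hasDerivAt⟩

theorem const (c s t : ℝ) : HasAEDerivOn (fun _ => c) (fun _ => 0) s t := by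
  simpa using of_contDiff (contDiff_const (c := c)) s t

theorem const_mul (c : ℝ) (hf : HasAEDerivOn f h s t) :
    HasAEDerivOn (fun x => c * f x) (fun x => c * h x) s t := by
  simpa using (const c s t).mul hf

theorem of_intervalIntegrable (hk : IntervalIntegrable k volume s t) :
    HasAEDerivOn (fun x => ∫ y in s..x, k y) k s t := by
  refine ⟨hk.absolutelyContinuousOnInterval_intervalIntegral left_mem_uIcc, ?_⟩
  filter_upwards [hk.ae_hasDerivAt_integral] with x hx hx'
  exact hx hx' s left_mem_uIcc

/-- Agreement on `[s, t]` alone suffices: the endpoints, where two-sided derivatives could differ,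
form a null set. -/
theorem congr (hf : HasAEDerivOn f h s t) (hst : s ≤ t) (hfg : ∀ x ∈ Icc s t, g x = f x) :
    HasAEDerivOn g h s t := by
  refine ⟨?_, ?_⟩
  · have hac := hf.ac
    rw [absolutelyContinuousOnInterval_iff] at hac ⊢
    intro ε hε
    obtain ⟨δ, hδ, H⟩ := hac ε hε
    refine ⟨δ, hδ, fun I hI hlt => ?_⟩
    have := H I hI hlt
    refine lt_of_eq_of_lt (Finset.sum_congr rfl fun i hi => ?_) this
    have h1 := hI.1 i hi
    rw [uIcc_of_le hst] at h1
    rw [hfg _ h1.1, hfg _ h1.2]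
  · have h1 : ∀ᵐ x : ℝ, x ≠ s := by simp [ae_iff]
    have h2 : ∀ᵐ x : ℝ, x ≠ t := by simp [ae_iff]
    filter_upwards [hf.deriv, h1, h2] with x hx hxs hxt hx'
    refine (hx hx').congr_of_eventuallyEq ?_
    rw [uIcc_of_le hst] at hx'
    filter_upwards [Icc_mem_nhds (lt_of_le_of_ne hx'.1 hxs.symm) (lt_of_le_of_ne hx'.2 hxt)]
      with y hy using hfg y hy

/-- Comparison principle: `f' ≥ -K f + φ` integrates to an inequality for `e^{Kx} f x`. -/
theorem integral_exp_mul_le {K : ℝ} {φ : ℝ → ℝ} (hf : HasAEDerivOn f h s t) (hst : s ≤ t)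
    (hφ : IntervalIntegrable φ volume s t)
    (hle : ∀ᵐ x, x ∈ Ioo s t → -K * f x + φ x ≤ h x) :
    ∫ x in s..t, Real.exp (K * x) * φ x ≤ Real.exp (K * t) * f t - Real.exp (K * s) * f s := by
  have hE : HasAEDerivOn (fun x => Real.exp (K * x)) (fun x => K * Real.exp (K * x)) s t := by
    have hd : ∀ x : ℝ, HasDerivAt (fun x => Real.exp (K * x)) (K * Real.exp (K * x)) x := by
      intro x
      simpa [mul_comm] using ((hasDerivAt_id x).const_mul K).exp
    exact ⟨(by fun_prop : ContDiff ℝ 1 fun x => Real.exp (K * x)).contDiffOn.absolutelyContinuousOnInterval,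
      ae_of_all _ fun x _ => hd x⟩
  have hP := hE.mul hf
  rw [← hP.ac.integral_deriv_eq_sub]
  refine intervalIntegral.integral_mono_ae_restrict hst
    (hφ.continuousOn_mul (by fun_prop)) hP.ac.intervalIntegrable_deriv ?_
  rw [Filter.EventuallyLE, ae_restrict_iff' measurableSet_Icc]
  have h1 : ∀ᵐ x : ℝ, x ≠ s := by simp [ae_iff]
  have h2 : ∀ᵐ x : ℝ, x ≠ t := by simp [ae_iff]
  filter_upwards [hP.deriv, hle, h1, h2] with x hx hx2 hxs hxt hxI
  rw [(hx (by rwa [uIcc_of_le hst])).deriv]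
  have := hx2 ⟨lt_of_le_of_ne hxI.1 hxs.symm, lt_of_le_of_ne hxI.2 hxt⟩
  nlinarith [Real.exp_pos (K * x)]

theorem exp_mul_le {K : ℝ} (hf : HasAEDerivOn f h s t) (hst : s ≤ t)
    (hle : ∀ᵐ x, x ∈ Ioo s t → -K * f x ≤ h x) :
    Real.exp (-K * (t - s)) * f s ≤ f t := by
  have := hf.integral_exp_mul_le (K := K) (φ := fun _ => 0) hst (by simp) (by simpa using hle)
  simp only [mul_zero, intervalIntegral.integral_zero, sub_nonneg] at this
  have h1 : Real.exp (-K * (t - s)) = Real.exp (-(K * t)) * Real.exp (K * s) := by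
    rw [← Real.exp_add]; congr 1; ring
  rw [h1, mul_assoc]
  calc Real.exp (-(K * t)) * (Real.exp (K * s) * f s)
      ≤ Real.exp (-(K * t)) * (Real.exp (K * t) * f t) := by gcongr
    _ = f t := by rw [← mul_assoc, ← Real.exp_add]; simp

end HasAEDerivOn

/-! ### Consensus inequalities -/

section Consensus

variable {n : ℕ} {A : ℝ → Fin n → Fin n → ℝ} {U H : Fin n → ℝ → ℝ} {s t : ℝ}

/-- The term `j = i` vanishes, and each of the other `n - 1` terms is at least `-u i`. -/
theorem neg_mul_le_sum_weights {a u : Fin n → ℝ} {i : Fin n} (ha : ∀ j, a j ∈ Icc (0 : ℝ) 1)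
    (hu : ∀ j, 0 ≤ u j) : -((n : ℝ) - 1) * u i ≤ ∑ j, a j * (u j - u i) := by
  rw [← Finset.add_sum_erase _ _ (Finset.mem_univ i)]
  have : ∑ j ∈ Finset.univ.erase i, (-(u i)) ≤ ∑ j ∈ Finset.univ.erase i, a j * (u j - u i) :=
    Finset.sum_le_sum fun j _ => by
      have h1 := (ha j).1; have h2 := (ha j).2
      nlinarith [hu j, hu i, mul_nonneg h1 (hu j)]
  have hn : 1 ≤ n := by have := i.2; omega
  simp [Finset.card_erase_of_mem, Nat.cast_sub hn] at this ⊢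
  linarith

theorem neg_mul_add_le_sum_weights {a u : Fin n → ℝ} {i l : Fin n} (hil : l ≠ i)
    (ha : ∀ j, a j ∈ Icc (0 : ℝ) 1) (hu : ∀ j, 0 ≤ u j) :
    -((n : ℝ) - 1) * u i + a l * u l ≤ ∑ j, a j * (u j - u i) := by
  rw [← Finset.add_sum_erase _ _ (Finset.mem_univ i)]
  have hl : l ∈ Finset.univ.erase i := by simp [hil]
  have : ∑ j ∈ Finset.univ.erase i, (-(u i) + if j = l then a l * u l else 0) ≤
      ∑ j ∈ Finset.univ.erase i, a j * (u j - u i) :=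
    Finset.sum_le_sum fun j _ => by
      have h1 := (ha j).1; have h2 := (ha j).2
      split_ifs with h
      · subst h; nlinarith [hu j, hu i]
      · nlinarith [hu j, hu i, mul_nonneg h1 (hu j)]
  rw [Finset.sum_add_distrib, Finset.sum_ite_eq' _ l, if_pos hl] at this
  have hn : 1 ≤ n := by have := i.2; omega
  simp [Finset.card_erase_of_mem, Nat.cast_sub hn] at this ⊢
  linarith

/-- Supersolutions of the consensus dynamics that start nonnegative stay nonnegative. -/
theorem consensus_nonneg (hst : s ≤ t) (hA : ∀ τ i j, A τ i j ∈ Icc (0 : ℝ) 1)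
    (hU : ∀ i, HasAEDerivOn (U i) (H i) s t)
    (hH : ∀ τ ∈ Icc s t, ∀ i, ∑ j, A τ i j * (U j τ - U i τ) ≤ H i τ)
    (h0 : ∀ i, 0 ≤ U i s) : ∀ τ ∈ Icc s t, ∀ i, 0 ≤ U i τ := by
  -- Shift by `ε` and look at the first time some `U i + ε` reaches `≤ 0`. Before it all shifted
  -- values are nonnegative, so that component decays no faster than `exp(-(n - 1)τ)` and is still
  -- positive: a contradiction.
  have key : ∀ ε > 0, ∀ τ ∈ Icc s t, ∀ i, 0 ≤ U i τ + ε := by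
    intro ε hε
    by_contra! hneg
    obtain ⟨τ₁, hτ₁, i₁, hi₁⟩ := hneg
    have hcomp : IsCompact (⋃ i, (Icc s t ∩ (fun τ => U i τ + ε) ⁻¹' Iic 0)) :=
      isCompact_iUnion fun i => isCompact_Icc.of_isClosed_subset
        (((hU i).continuousOn hst |>.add continuousOn_const).preimage_isClosed_of_isClosed
          isClosed_Icc isClosed_Iic) inter_subset_left
    obtain ⟨τ₀, hτ₀, hmin⟩ := hcomp.exists_isLeast ⟨τ₁, mem_iUnion.2 ⟨i₁, hτ₁, hi₁.le⟩⟩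
    obtain ⟨i, hτ₀I, hi⟩ := mem_iUnion.1 hτ₀
    have hpos : ∀ τ ∈ Ioo s τ₀, ∀ j, 0 ≤ U j τ + ε := by
      intro τ hτ j
      by_contra! hlt
      exact absurd (hmin (mem_iUnion.2 ⟨j, ⟨hτ.1.le, hτ.2.le.trans hτ₀I.2⟩, hlt.le⟩))
        (not_le.2 hτ.2)
    have hd := ((hU i).mono le_rfl hτ₀I.1 hτ₀I.2).add (HasAEDerivOn.const ε s τ₀)
    have := hd.exp_mul_le (K := (n : ℝ) - 1) hτ₀I.1 (ae_of_all _ fun τ hτ => by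
      refine (neg_mul_le_sum_weights (hA τ i) (hpos τ hτ)).trans ?_
      simpa using hH τ ⟨hτ.1.le, hτ.2.le.trans hτ₀I.2⟩ i)
    have h1 : 0 < Real.exp (-((n : ℝ) - 1) * (τ₀ - s)) * (U i s + ε) :=
      mul_pos (Real.exp_pos _) (by linarith [h0 i])
    exact absurd hi (not_le.2 (h1.trans_le this))
  intro τ hτ i
  exact le_of_forall_pos_le_add fun ε hε => key ε hε τ hτ i

theorem consensus_exp_mul_le (hst : s ≤ t) (hA : ∀ τ i j, A τ i j ∈ Icc (0 : ℝ) 1)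
    (hU : ∀ i, HasAEDerivOn (U i) (H i) s t)
    (hH : ∀ τ ∈ Icc s t, ∀ i, ∑ j, A τ i j * (U j τ - U i τ) ≤ H i τ)
    (h0 : ∀ i, 0 ≤ U i s) {τ : ℝ} (hτ : τ ∈ Icc s t) (i : Fin n) :
    Real.exp (-((n : ℝ) - 1) * (τ - s)) * U i s ≤ U i τ :=
  ((hU i).mono le_rfl hτ.1 hτ.2).exp_mul_le hτ.1 (ae_of_all _ fun σ hσ =>
    have hσ' : σ ∈ Icc s t := ⟨hσ.1.le, hσ.2.le.trans hτ.2⟩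
    (neg_mul_le_sum_weights (hA σ i) (consensus_nonneg hst hA hU hH h0 σ hσ')).trans (hH σ hσ' i))

/-- While `U j` stays above `v exp(-(n - 1)(τ - s))`, node `i` gains at rate at least `A i j * U j`
and loses at rate at most `(n - 1) U i`. The two exponentials combine to a constant, so only the
integrated weight of the edge matters. -/
theorem consensus_edge_le (hst : s ≤ t) (hA : ∀ τ i j, A τ i j ∈ Icc (0 : ℝ) 1)
    (hmeas : ∀ i j, Measurable fun τ => A τ i j)
    (hU : ∀ i, HasAEDerivOn (U i) (H i) s t)
    (hH : ∀ τ ∈ Icc s t, ∀ i, ∑ j, A τ i j * (U j τ - U i τ) ≤ H i τ)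
    (h0 : ∀ i, 0 ≤ U i s) {i j : Fin n} (hij : j ≠ i) {δ v : ℝ} (hδ : δ ≤ ∫ τ in s..t, A τ i j)
    (hv0 : 0 ≤ v) (hv : v ≤ U j s) :
    δ * Real.exp (-((n : ℝ) - 1) * (t - s)) * v ≤ U i t := by
  set K : ℝ := (n : ℝ) - 1
  have hAint : IntervalIntegrable (fun τ => A τ i j) volume s t :=
    (intervalIntegrable_const (c := (1 : ℝ))).mono_fun (hmeas i j).aestronglyMeasurable
      (ae_of_all _ fun τ => by
        simpa [abs_of_nonneg (hA τ i j).1] using (hA τ i j).2)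
  have hφ : IntervalIntegrable (fun τ => A τ i j * (Real.exp (-K * (τ - s)) * v)) volume s t :=
    hAint.mul_continuousOn (by fun_prop)
  have := (hU i).integral_exp_mul_le (K := K) hst hφ (ae_of_all _ fun σ hσ => by
    have hσ' : σ ∈ Icc s t := ⟨hσ.1.le, hσ.2.le⟩
    refine le_trans ?_ (hH σ hσ' i)
    refine le_trans ?_ (neg_mul_add_le_sum_weights hij (hA σ i)
      (consensus_nonneg hst hA hU hH h0 σ hσ'))
    have h1 := consensus_exp_mul_le hst hA hU hH h0 hσ' j
    have h2 : Real.exp (-K * (σ - s)) * v ≤ U j σ :=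
      (mul_le_mul_of_nonneg_left hv (Real.exp_pos _).le).trans h1
    have h3 := mul_le_mul_of_nonneg_left h2 (hA σ i j).1
    linarith)
  have hint : ∫ x in s..t, Real.exp (K * x) * (A x i j * (Real.exp (-K * (x - s)) * v)) =
      Real.exp (K * s) * v * ∫ x in s..t, A x i j := by
    rw [← intervalIntegral.integral_const_mul]
    refine intervalIntegral.integral_congr fun x _ => ?_
    have : Real.exp (K * x) * Real.exp (-K * (x - s)) = Real.exp (K * s) := by
      rw [← Real.exp_add]; congr 1; ring
    simp only [← this]; ring
  rw [hint] at this
  have h4 : Real.exp (K * s) * v * δ ≤ Real.exp (K * t) * U i t := by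
    have h5 : 0 ≤ Real.exp (K * s) * v := by positivity
    have h6 : 0 ≤ Real.exp (K * s) * U i s := mul_nonneg (Real.exp_pos _).le (h0 i)
    linarith [mul_le_mul_of_nonneg_left hδ h5]
  have h7 : Real.exp (-K * (t - s)) = Real.exp (-(K * t)) * Real.exp (K * s) := by
    rw [← Real.exp_add]; congr 1; ring
  calc δ * Real.exp (-K * (t - s)) * v = Real.exp (-(K * t)) * (Real.exp (K * s) * v * δ) := by
        rw [h7]; ring
    _ ≤ Real.exp (-(K * t)) * (Real.exp (K * t) * U i t) := by gcongr
    _ = U i t := by rw [← mul_assoc, ← Real.exp_add]; simp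

/-- Over a window on which node `r` is a root of the `δ`-digraph, a superlevel set of a nonnegative
supersolution persists at a reduced level, and it grows if it contains `r` and is not everything. -/
theorem consensus_superlevel (hst : s ≤ t) (hA : ∀ τ i j, A τ i j ∈ Icc (0 : ℝ) 1)
    (hmeas : ∀ i j, Measurable fun τ => A τ i j)
    (hU : ∀ i, HasAEDerivOn (U i) (H i) s t)
    (hH : ∀ τ ∈ Icc s t, ∀ i, ∑ j, A τ i j * (U j τ - U i τ) ≤ H i τ)
    (h0 : ∀ i, 0 ≤ U i s) {δ v d : ℝ} (hv : 0 ≤ v)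
    (hd : d = min 1 δ * Real.exp (-((n : ℝ) - 1) * (t - s))) {r : Fin n}
    (hr : ∀ i, Relation.ReflTransGen (fun j i => j ≠ i → δ ≤ ∫ τ in s..t, A τ i j) r i) :
    (∀ i, v ≤ U i s → d * v ≤ U i t) ∧
      (v ≤ U r s → (∃ i, U i s < v) → ∃ i, U i s < v ∧ d * v ≤ U i t) := by
  have hE := Real.exp_pos (-((n : ℝ) - 1) * (t - s))
  refine ⟨fun i hi => ?_, fun hr0 ⟨i, hi⟩ => ?_⟩
  · refine le_trans ?_ (consensus_exp_mul_le hst hA hU hH h0 (right_mem_Icc.2 hst) i)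
    calc d * v ≤ 1 * Real.exp (-((n : ℝ) - 1) * (t - s)) * v := by
          rw [hd]; gcongr; exact min_le_left _ _
      _ ≤ _ := by rw [one_mul]; gcongr
  -- A path from the root to a node below the level must cross an edge leaving the superlevel set.
  · have hcross : ∃ j i, v ≤ U j s ∧ U i s < v ∧ (j ≠ i → δ ≤ ∫ τ in s..t, A τ i j) := by
      by_contra! hno
      have : ∀ i, Relation.ReflTransGen (fun j i => j ≠ i → δ ≤ ∫ τ in s..t, A τ i j) r i →
          v ≤ U i s := by
        intro i hi
        induction hi with
        | refl => exact hr0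
        | tail _ hbc ih =>
          rename_i b c _
          by_contra! hc
          obtain ⟨h1, h2⟩ := hno b c ih hc
          exact absurd (hbc h1) (not_le.2 h2)
      exact absurd (this i (hr i)) (not_le.2 hi)
    obtain ⟨j, i, hj, hi, hji⟩ := hcross
    have hne : j ≠ i := by rintro rfl; exact absurd hj (not_le.2 hi)
    refine ⟨i, hi, le_trans ?_ (consensus_edge_le hst hA hmeas hU hH h0 hne (hji hne) hv hj)⟩
    rw [hd]; gcongr; exact min_le_right _ _

end Consensus

end TimeCoordination

namespace TimeCoordination

/-! ### Contraction of the diameter -/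

section Contraction

variable {n : ℕ} {A : ℝ → Fin n → Fin n → ℝ} {U L H G : Fin n → ℝ → ℝ} {s T δ d : ℝ}

/-- The digraph of the weights `A` integrated over `[t, t + T]` has a `δ`-spanning tree. -/
def HasWeightedSpanningTree (A : ℝ → Fin n → Fin n → ℝ) (t T δ : ℝ) : Prop :=
  ∃ r, ∀ i, Relation.ReflTransGen (fun j i => j ≠ i → δ ≤ ∫ τ in t..(t + T), A τ i j) r i

open Classical in
theorem card_superlevel_le {f g : Fin n → ℝ} {v v' : ℝ} (h : ∀ i, v ≤ f i → v' ≤ g i) :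
    (Finset.univ.filter fun i => v ≤ f i).card ≤ (Finset.univ.filter fun i => v' ≤ g i).card :=
  Finset.card_le_card fun i hi => by simpa using h i (by simpa using hi)

open Classical in
theorem card_superlevel_lt {f g : Fin n → ℝ} {v v' : ℝ} (h : ∀ i, v ≤ f i → v' ≤ g i)
    (h' : ∃ i, f i < v ∧ v' ≤ g i) :
    (Finset.univ.filter fun i => v ≤ f i).card < (Finset.univ.filter fun i => v' ≤ g i).card := by
  obtain ⟨i, hi, hi'⟩ := h'
  refine Finset.card_lt_card (Finset.ssubset_iff_of_subset
    (fun i hi => by simpa using h i (by simpa using hi)) |>.2 ⟨i, by simpa using hi', by simpa using hi⟩)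

open Classical in
-- Induction on windows. The first two alternatives are absorbing, since a full superlevel set stays
-- full at the reduced level; otherwise the two sets still cover all nodes and their total size
-- rises by at least one per window.
theorem superlevel_growth (hT : 0 < T) {N : ℕ} (hA : ∀ τ i j, A τ i j ∈ Icc (0 : ℝ) 1)
    (hmeas : ∀ i j, Measurable fun τ => A τ i j)
    (htree : ∀ t ∈ Icc s (s + N * T), HasWeightedSpanningTree A t T δ)
    (hU : ∀ i, HasAEDerivOn (U i) (H i) s (s + N * T))
    (hH : ∀ τ ∈ Icc s (s + N * T), ∀ i, ∑ j, A τ i j * (U j τ - U i τ) ≤ H i τ)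
    (hU0 : ∀ i, 0 ≤ U i s)
    (hL : ∀ i, HasAEDerivOn (L i) (G i) s (s + N * T))
    (hG : ∀ τ ∈ Icc s (s + N * T), ∀ i, ∑ j, A τ i j * (L j τ - L i τ) ≤ G i τ)
    (hL0 : ∀ i, 0 ≤ L i s) {v : ℝ} (hv : 0 ≤ v) (hUL : ∀ i, v ≤ U i s ∨ v ≤ L i s)
    (hδ : 0 ≤ δ) (hd : d = min 1 δ * Real.exp (-((n : ℝ) - 1) * T)) {k : ℕ} (hk : k ≤ N) :
    (∀ i, d ^ k * v ≤ U i (s + k * T)) ∨ (∀ i, d ^ k * v ≤ L i (s + k * T)) ∨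
      (∀ i, d ^ k * v ≤ U i (s + k * T) ∨ d ^ k * v ≤ L i (s + k * T)) ∧
      n + k ≤ (Finset.univ.filter fun i => d ^ k * v ≤ U i (s + k * T)).card +
        (Finset.univ.filter fun i => d ^ k * v ≤ L i (s + k * T)).card := by
  have hd0 : 0 ≤ d := by rw [hd]; positivity
  have hst : s ≤ s + N * T := by have : 0 ≤ (N : ℝ) * T := by positivity
                                 linarith
  induction k with
  | zero =>
    right; right
    simp only [pow_zero, one_mul, Nat.cast_zero, zero_mul, add_zero]
    refine ⟨hUL, ?_⟩
    rw [← Finset.card_union_add_card_inter]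
    refine le_trans ?_ (Nat.le_add_right _ _)
    rw [← Finset.filter_or, Finset.filter_true_of_mem fun i _ => hUL i]
    simp
  | succ k ih =>
    have hkN : (k : ℝ) + 1 ≤ N := by exact_mod_cast hk
    have hkT : ((k : ℝ) + 1) * T ≤ N * T := by gcongr
    have hkT0 : 0 ≤ (k : ℝ) * T := by positivity
    have hsub : Icc (s + k * T) (s + k * T + T) ⊆ Icc s (s + N * T) :=
      Icc_subset_Icc (by linarith) (by linarith)
    have hmem : s + k * T ∈ Icc s (s + N * T) := hsub (left_mem_Icc.2 (by linarith))
    have hst' : s + k * T ≤ s + k * T + T := by linarith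
    have hd' : d = min 1 δ * Real.exp (-((n : ℝ) - 1) * (s + k * T + T - (s + k * T))) := by
      rw [hd]; congr 3; ring
    have hvk : 0 ≤ d ^ k * v := by positivity
    obtain ⟨r, hr⟩ := htree _ hmem
    have hSU := consensus_superlevel hst' hA hmeas
      (fun i => (hU i).mono hmem.1 hst' (by linarith)) (fun τ hτ => hH τ (hsub hτ))
      (fun i => consensus_nonneg hst hA hU hH hU0 _ hmem i) hvk hd' hr
    have hSL := consensus_superlevel hst' hA hmeas
      (fun i => (hL i).mono hmem.1 hst' (by linarith)) (fun τ hτ => hG τ (hsub hτ))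
      (fun i => consensus_nonneg hst hA hL hG hL0 _ hmem i) hvk hd' hr
    have he : s + ((k + 1 : ℕ) : ℝ) * T = s + k * T + T := by push_cast; ring
    have hp : d ^ (k + 1) * v = d * (d ^ k * v) := by ring
    rw [he, hp]
    by_cases hUall : ∀ i, d ^ k * v ≤ U i (s + k * T)
    · exact Or.inl fun i => hSU.1 i (hUall i)
    by_cases hLall : ∀ i, d ^ k * v ≤ L i (s + k * T)
    · exact Or.inr (Or.inl fun i => hSL.1 i (hLall i))
    obtain ⟨hor, hcard⟩ := ((ih (by omega)).resolve_left hUall).resolve_left hLall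
    push Not at hUall hLall
    refine Or.inr (Or.inr ⟨fun i => (hor i).imp (hSU.1 i) (hSL.1 i), ?_⟩)
    have hU1 := card_superlevel_le hSU.1
    have hL1 := card_superlevel_le hSL.1
    -- The root of this window, which may change from window to window, lies in one of the two sets.
    -- That set is proper, hence grows, and the other does not shrink in size.
    rcases hor r with hrU | hrL
    · have := card_superlevel_lt hSU.1 (hSU.2 hrU hUall)
      omega
    · have := card_superlevel_lt hSL.1 (hSL.2 hrL hLall)
      omega

theorem superlevel_eventually_all (hn : 1 ≤ n) (hT : 0 < T)
    (hA : ∀ τ i j, A τ i j ∈ Icc (0 : ℝ) 1)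
    (hmeas : ∀ i j, Measurable fun τ => A τ i j) {t : ℝ} (ht : t = s + ((n : ℝ) - 1) * T)
    (htree : ∀ τ ∈ Icc s t, HasWeightedSpanningTree A τ T δ)
    (hU : ∀ i, HasAEDerivOn (U i) (H i) s t)
    (hH : ∀ τ ∈ Icc s t, ∀ i, ∑ j, A τ i j * (U j τ - U i τ) ≤ H i τ)
    (hU0 : ∀ i, 0 ≤ U i s)
    (hL : ∀ i, HasAEDerivOn (L i) (G i) s t)
    (hG : ∀ τ ∈ Icc s t, ∀ i, ∑ j, A τ i j * (L j τ - L i τ) ≤ G i τ)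
    (hL0 : ∀ i, 0 ≤ L i s) {v : ℝ} (hv : 0 ≤ v) (hUL : ∀ i, v ≤ U i s ∨ v ≤ L i s)
    (hδ : 0 ≤ δ) (hd : d = min 1 δ * Real.exp (-((n : ℝ) - 1) * T)) :
    (∀ i, d ^ (n - 1) * v ≤ U i t) ∨ (∀ i, d ^ (n - 1) * v ≤ L i t) := by
  classical
  have ht' : t = s + ((n - 1 : ℕ) : ℝ) * T := by rw [ht, Nat.cast_sub hn]; simp
  subst ht'
  rcases superlevel_growth hT hA hmeas htree hU hH hU0 hL hG hL0 hv hUL hδ hd le_rfl with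
    h | h | ⟨-, h⟩
  · exact Or.inl h
  · exact Or.inr h
  -- Two proper subsets have total size at most `2n - 2`, against the count `n + (n - 1)`.
  by_contra! hne
  obtain ⟨⟨i, hi⟩, ⟨j, hj⟩⟩ := hne
  have h1 := Finset.card_lt_card (Finset.filter_ssubset (s := Finset.univ)
    (p := fun i => d ^ (n - 1) * v ≤ U i (s + ((n - 1 : ℕ) : ℝ) * T)).2
    ⟨i, Finset.mem_univ i, not_le.2 hi⟩)
  have h2 := Finset.card_lt_card (Finset.filter_ssubset (s := Finset.univ)
    (p := fun i => d ^ (n - 1) * v ≤ L i (s + ((n - 1 : ℕ) : ℝ) * T)).2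
    ⟨j, Finset.mem_univ j, not_le.2 hj⟩)
  simp only [Finset.card_univ, Fintype.card_fin] at h1 h2
  omega

/-! ### Drifting envelopes and the diameter of a disturbed consensus system -/

variable {y y' : Fin n → ℝ → ℝ} {w : ℝ → ℝ} {g t : ℝ}

/-- Moving the level `M` with the common drift and the largest disturbance `g` makes its distance to
`y i` a supersolution; the drift cancels in all differences. -/
theorem upper_envelope (hw : IntervalIntegrable w volume s t)
    (hy : ∀ i, HasAEDerivOn (y i) (y' i) s t)
    (hy' : ∀ τ ∈ Icc s t, ∀ i, |y' i τ - w τ - ∑ j, A τ i j * (y j τ - y i τ)| ≤ g) (M : ℝ) :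
    ∃ U H : Fin n → ℝ → ℝ, (∀ i, HasAEDerivOn (U i) (H i) s t) ∧
      (∀ τ ∈ Icc s t, ∀ i, ∑ j, A τ i j * (U j τ - U i τ) ≤ H i τ) ∧
      (∀ i, U i s = M - y i s) ∧
      ∀ i, U i t = M + (∫ x in s..t, w x) + g * (t - s) - y i t := by
  refine ⟨fun i τ => M + (∫ x in s..τ, w x) + g * (τ - s) - y i τ,
    fun i τ => w τ + g - y' i τ, fun i => ?_, fun τ hτ i => ?_, fun i => by simp, fun i => rfl⟩
  · have h1 := (HasAEDerivOn.const M s t).add (HasAEDerivOn.of_intervalIntegrable hw)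
    have h2 : HasAEDerivOn (fun τ => g * (τ - s)) (fun _ => g) s t := by
      have := HasAEDerivOn.of_contDiff (f := fun τ : ℝ => g * (τ - s)) (by fun_prop) s t
      simpa using this
    simpa using (h1.add h2).sub (hy i)
  · have h := (abs_le.1 (hy' τ hτ i)).2
    have : ∑ j, A τ i j * ((M + (∫ x in s..τ, w x) + g * (τ - s) - y j τ) -
        (M + (∫ x in s..τ, w x) + g * (τ - s) - y i τ)) = -∑ j, A τ i j * (y j τ - y i τ) := by
      rw [← Finset.sum_neg_distrib]
      exact Finset.sum_congr rfl fun j _ => by ring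
    rw [this]; linarith

theorem lower_envelope (hw : IntervalIntegrable w volume s t)
    (hy : ∀ i, HasAEDerivOn (y i) (y' i) s t)
    (hy' : ∀ τ ∈ Icc s t, ∀ i, |y' i τ - w τ - ∑ j, A τ i j * (y j τ - y i τ)| ≤ g) (m : ℝ) :
    ∃ L G : Fin n → ℝ → ℝ, (∀ i, HasAEDerivOn (L i) (G i) s t) ∧
      (∀ τ ∈ Icc s t, ∀ i, ∑ j, A τ i j * (L j τ - L i τ) ≤ G i τ) ∧
      (∀ i, L i s = y i s - m) ∧
      ∀ i, L i t = y i t - (m + (∫ x in s..t, w x) - g * (t - s)) := by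
  have hneg : ∀ {f h : ℝ → ℝ}, HasAEDerivOn f h s t →
      HasAEDerivOn (fun x => -f x) (fun x => -h x) s t := fun hf => by simpa using hf.const_mul (-1)
  obtain ⟨U, H, h1, h2, h3, h4⟩ := upper_envelope (A := A) (y := fun i τ => -y i τ)
    (y' := fun i τ => -y' i τ) (w := fun τ => -w τ) hw.neg (fun i => hneg (hy i))
    (fun τ hτ i => by
      have : ∑ j, A τ i j * (-y j τ - -y i τ) = -∑ j, A τ i j * (y j τ - y i τ) := by
        rw [← Finset.sum_neg_distrib]
        exact Finset.sum_congr rfl fun j _ => by ring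
      rw [this, ← abs_neg]
      refine le_of_eq_of_le ?_ (hy' τ hτ i)
      congr 1; ring) (-m)
  refine ⟨U, H, h1, h2, fun i => by rw [h3]; ring, fun i => ?_⟩
  rw [h4, intervalIntegral.integral_neg]; ring

/-- The diameter grows at most at twice the rate of the disturbance. -/
theorem diam_le (hst : s ≤ t) (hA : ∀ τ i j, A τ i j ∈ Icc (0 : ℝ) 1)
    (hw : IntervalIntegrable w volume s t)
    (hy : ∀ i, HasAEDerivOn (y i) (y' i) s t)
    (hy' : ∀ τ ∈ Icc s t, ∀ i, |y' i τ - w τ - ∑ j, A τ i j * (y j τ - y i τ)| ≤ g)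
    {V : ℝ} (hV : ∀ i j, y i s - y j s ≤ V) (i j : Fin n) :
    y i t - y j t ≤ V + 2 * g * (t - s) := by
  obtain ⟨p, -, hp⟩ := Finset.exists_max_image Finset.univ (fun i => y i s) ⟨i, Finset.mem_univ i⟩
  obtain ⟨q, -, hq⟩ := Finset.exists_min_image Finset.univ (fun i => y i s) ⟨i, Finset.mem_univ i⟩
  have ht : t ∈ Icc s t := right_mem_Icc.2 hst
  obtain ⟨U, H, h1, h2, h3, h4⟩ := upper_envelope (A := A) hw hy hy' (y p s)
  obtain ⟨L, G, k1, k2, k3, k4⟩ := lower_envelope (A := A) hw hy hy' (y q s)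
  have hUi := consensus_nonneg hst hA h1 h2
    (fun i => by rw [h3]; linarith [hp i (Finset.mem_univ i)]) t ht i
  have hLj := consensus_nonneg hst hA k1 k2
    (fun i => by rw [k3]; linarith [hq i (Finset.mem_univ i)]) t ht j
  rw [h4] at hUi
  rw [k4] at hLj
  linarith [hV p q]

/-- Over `n - 1` windows the diameter contracts, up to the disturbance. -/
theorem diam_contraction (hT : 0 < T) (hA : ∀ τ i j, A τ i j ∈ Icc (0 : ℝ) 1)
    (hmeas : ∀ i j, Measurable fun τ => A τ i j) (ht : t = s + ((n : ℝ) - 1) * T)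
    (htree : ∀ τ ∈ Icc s t, HasWeightedSpanningTree A τ T δ)
    (hw : IntervalIntegrable w volume s t)
    (hy : ∀ i, HasAEDerivOn (y i) (y' i) s t)
    (hy' : ∀ τ ∈ Icc s t, ∀ i, |y' i τ - w τ - ∑ j, A τ i j * (y j τ - y i τ)| ≤ g)
    {V : ℝ} (hV : ∀ i j, y i s - y j s ≤ V)
    (hδ : 0 ≤ δ) (hd : d = min 1 δ * Real.exp (-((n : ℝ) - 1) * T)) (i j : Fin n) :
    y i t - y j t ≤ (1 - d ^ (n - 1) / 2) * V + 2 * g * (t - s) := by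
  have hn : 1 ≤ n := by have := i.2; omega
  have hn' : (1 : ℝ) ≤ n := by exact_mod_cast hn
  have hst : s ≤ t := by rw [ht]; nlinarith
  obtain ⟨p, -, hp⟩ := Finset.exists_max_image Finset.univ (fun i => y i s) ⟨i, Finset.mem_univ i⟩
  obtain ⟨q, -, hq⟩ := Finset.exists_min_image Finset.univ (fun i => y i s) ⟨i, Finset.mem_univ i⟩
  replace hp := fun i => hp i (Finset.mem_univ i)
  replace hq := fun i => hq i (Finset.mem_univ i)
  have htt : t ∈ Icc s t := right_mem_Icc.2 hst
  obtain ⟨U, H, h1, h2, h3, h4⟩ := upper_envelope (A := A) hw hy hy' (y p s)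
  obtain ⟨L, G, k1, k2, k3, k4⟩ := lower_envelope (A := A) hw hy hy' (y q s)
  have hU0 : ∀ i, 0 ≤ U i s := fun i => by rw [h3]; linarith [hp i]
  have hL0 : ∀ i, 0 ≤ L i s := fun i => by rw [k3]; linarith [hq i]
  have hU := consensus_nonneg hst hA h1 h2 hU0 t htt
  have hL := consensus_nonneg hst hA k1 k2 hL0 t htt
  -- At level half the diameter every node is far from the maximum or far from the minimum, because
  -- the two distances add up to the diameter.
  have hall := superlevel_eventually_all hn hT hA hmeas ht htree h1 h2 hU0 k1 k2 hL0
    (v := (y p s - y q s) / 2) (by linarith [hp q]) (fun i => by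
      rw [h3, k3]
      by_contra! hc
      linarith [hc.1, hc.2]) hδ hd
  have hd0 : 0 ≤ d := by rw [hd]; positivity
  have hd1 : d ≤ 1 := by
    rw [hd]
    refine mul_le_one₀ (min_le_left _ _) (Real.exp_pos _).le (Real.exp_le_one_iff.2 ?_)
    nlinarith
  have hpow : d ^ (n - 1) ≤ 1 := pow_le_one₀ hd0 hd1
  have hcontr : y i t - y j t ≤
      (1 - d ^ (n - 1) / 2) * (y p s - y q s) + 2 * g * (t - s) := by
    have e1 := h4 i
    have e2 := k4 j
    rcases hall with h | h
    · linarith [h i, hL j]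
    · linarith [hU i, h j]
  have := mul_le_mul_of_nonneg_left (hV p q) (by linarith : 0 ≤ 1 - d ^ (n - 1) / 2)
  linarith

end Contraction

end TimeCoordination

namespace TimeCoordination

/-! ### Small-gain argument -/

section SmallGain

/-- Least constants let each estimate of the loop be read back as an inequality between the
constants themselves. -/
theorem exists_least_ratio {ι : Type*} [Finite ι] [Nonempty ι] {f : ι → ℝ → ℝ} {E : ℝ → ℝ}
    {s t : ℝ} (hst : s ≤ t) (hf : ∀ k, ContinuousOn (f k) (Icc s t)) (hE : ContinuousOn E (Icc s t))
    (hE0 : ∀ τ, 0 < E τ) :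
    ∃ v, (∀ τ ∈ Icc s t, ∀ k, f k τ ≤ v * E τ) ∧
      ∀ v', (∀ τ ∈ Icc s t, ∀ k, f k τ ≤ v' * E τ) → v ≤ v' := by
  have h1 : ∀ k, ∃ x ∈ Icc s t, IsMaxOn (fun τ => f k τ / E τ) (Icc s t) x := fun k =>
    isCompact_Icc.exists_isMaxOn (nonempty_Icc.2 hst) ((hf k).div hE fun τ _ => (hE0 τ).ne')
  choose x hx hmax using h1
  obtain ⟨k, hk⟩ := Finite.exists_max fun k => f k (x k) / E (x k)
  refine ⟨f k (x k) / E (x k), fun τ hτ j => ?_, fun v' hv' => ?_⟩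
  · rw [← div_le_iff₀ (hE0 τ)]
    exact (hmax j hτ).trans (hk j)
  · rw [div_le_iff₀ (hE0 _)]
    exact hv' _ (hx k) k

/-- A linear stable scalar equation driven by an input of size `c E` stays below `C E`. -/
theorem le_mul_of_stable {z z' E E' : ℝ → ℝ} {t b μ c C : ℝ} (ht : 0 ≤ t)
    (hz : HasAEDerivOn z z' 0 t) (hE : HasAEDerivOn E E' 0 t) (hE0 : ∀ τ, 0 < E τ)
    (hE' : ∀ τ, -μ * E τ ≤ E' τ) (hC : 0 ≤ C) (hc : c ≤ (b - μ) * C)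
    (hz' : ∀ᵐ τ, τ ∈ Ioo 0 t → z' τ + b * z τ ≤ c * E τ) (h0 : z 0 ≤ C * E 0) :
    z t ≤ C * E t := by
  have hψ := (hE.const_mul C).sub hz
  have := hψ.exp_mul_le (K := b) ht (by
    filter_upwards [hz'] with τ hτ hI
    have h1 := mul_le_mul_of_nonneg_left (hE' τ) hC
    have h2 := mul_le_mul_of_nonneg_right hc (hE0 τ).le
    linarith [hτ hI])
  have h1 : 0 ≤ Real.exp (-b * (t - 0)) * (C * E 0 - z 0) :=
    mul_nonneg (Real.exp_pos _).le (by linarith)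
  linarith

variable {n : ℕ} {A : ℝ → Fin n → Fin n → ℝ} {y y' z z' : Fin n → ℝ → ℝ} {w E E' : ℝ → ℝ}
  {T δ d b μ h η t₁ : ℝ}

/-- Consensus dynamics `y` and fast stable dynamics `z`, coupled with small gain, decay at the rate
`μ` of the reference profile `E`. -/
theorem small_gain (hn : 2 ≤ n) (hT : 0 < T) (hδ : 0 ≤ δ)
    (hd : d = min 1 δ * Real.exp (-((n : ℝ) - 1) * T)) (hη : η = d ^ (n - 1) / 2) (hη0 : 0 < η)
    (hh : h = ((n : ℝ) - 1) * T) (hμ : 0 < μ) (hμh : μ * h ≤ η / 4)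
    (hb1 : 8 * n ≤ b) (hb2 : 2 * μ ≤ b) (hb3 : 128 * h * n ^ 2 ≤ η * b) (ht₁ : 0 ≤ t₁)
    (hA : ∀ τ i j, A τ i j ∈ Icc (0 : ℝ) 1) (hmeas : ∀ i j, Measurable fun τ => A τ i j)
    (htree : ∀ τ, 0 ≤ τ → HasWeightedSpanningTree A τ T δ)
    (hw : IntervalIntegrable w volume 0 t₁)
    (hE : HasAEDerivOn E E' 0 t₁) (hE0 : ∀ τ, 0 < E τ) (hE' : ∀ τ, -μ * E τ ≤ E' τ)
    (hEexp : ∀ σ τ, σ ≤ τ → E σ ≤ Real.exp (μ * (τ - σ)) * E τ)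
    (hy : ∀ i, HasAEDerivOn (y i) (y' i) 0 t₁)
    (hy' : ∀ τ ∈ Icc 0 t₁, ∀ Z, (∀ i, |z i τ| ≤ Z) → ∀ i,
      |y' i τ - w τ - ∑ j, A τ i j * (y j τ - y i τ)| ≤ (2 * n * Z + E τ) / b)
    (hz : ∀ i, HasAEDerivOn (z i) (z' i) 0 t₁)
    (hz' : ∀ τ ∈ Ioo 0 t₁, ∀ V Z, (∀ i j, y i τ - y j τ ≤ V) → (∀ i, |z i τ| ≤ Z) →
      ∀ i, |z' i τ + b * z i τ| ≤ b * n * V + 2 * n * Z + E τ)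
    (hy0 : ∀ i j, y i 0 - y j 0 ≤ E 0) (hz0 : ∀ i, |z i 0| ≤ E 0) :
    ∀ τ ∈ Icc 0 t₁, (∀ i j, y i τ - y j τ ≤ 12 / η * E τ) ∧
      ∀ i, |z i τ| ≤ (3 + 48 * n / η) * E τ := by
  have : Nonempty (Fin n) := ⟨⟨0, by omega⟩⟩
  have hn' : (2 : ℝ) ≤ n := by exact_mod_cast hn
  have hh0 : 0 < h := by rw [hh]; nlinarith
  have hb0 : 0 < b := by linarith
  have hd0 : 0 ≤ d := by rw [hd]; positivity
  have hd1 : d ≤ 1 := by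
    rw [hd]
    exact mul_le_one₀ (min_le_left _ _) (Real.exp_pos _).le
      (Real.exp_le_one_iff.2 (by nlinarith))
  have hη1 : η ≤ 1 / 2 := by
    have : d ^ (n - 1) ≤ 1 := pow_le_one₀ hd0 hd1
    rw [hη]; linarith
  have h0mem : (0 : ℝ) ∈ Icc 0 t₁ := left_mem_Icc.2 ht₁
  obtain ⟨v, hv, hvmin⟩ := exists_least_ratio (ι := Fin n × Fin n)
    (f := fun k τ => y k.1 τ - y k.2 τ) ht₁
    (fun k => ((hy k.1).continuousOn ht₁).sub ((hy k.2).continuousOn ht₁)) (hE.continuousOn ht₁) hE0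
  obtain ⟨ζ, hζ, hζmin⟩ := exists_least_ratio (ι := Fin n)
    (f := fun k τ => |z k τ|) ht₁
    (fun k => ((hz k).continuousOn ht₁).abs) (hE.continuousOn ht₁) hE0
  have i₀ : Fin n := ⟨0, by omega⟩
  have hv0 : 0 ≤ v := by
    have := hv 0 h0mem (i₀, i₀)
    simp only [sub_self] at this
    exact nonneg_of_mul_nonneg_left this (hE0 0)
  have hζ0 : 0 ≤ ζ :=
    nonneg_of_mul_nonneg_left ((abs_nonneg _).trans (hζ 0 h0mem i₀)) (hE0 0)
  -- `c` is the forcing of `z` in units of `E`. Since `b - μ ≥ b / 2`, the level `1 + 2 c / b`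
  -- dominates both the initial value and the forcing.
  have hzbound : ζ ≤ 1 + 2 / b * (b * n * v + 2 * n * ζ + 1) := by
    refine hζmin _ fun t ht i => ?_
    set c : ℝ := b * n * v + 2 * n * ζ + 1 with hc
    have hc0 : 0 ≤ c := by positivity
    have hC0 : 0 ≤ 1 + 2 / b * c := by positivity
    have hcC : c ≤ (b - μ) * (1 + 2 / b * c) := by
      have h1 : b / 2 ≤ b - μ := by linarith
      calc c = b / 2 * (2 / b * c) := by field_simp
        _ ≤ (b - μ) * (1 + 2 / b * c) := by gcongr <;> linarith
    have hbd : ∀ τ ∈ Ioo 0 t, |z' i τ + b * z i τ| ≤ c * E τ := fun τ hτ => by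
      have hτ' : τ ∈ Ioo 0 t₁ := ⟨hτ.1, hτ.2.trans_le ht.2⟩
      have hτI := Ioo_subset_Icc_self hτ'
      refine (hz' τ hτ' _ _ (fun i j => hv τ hτI (i, j)) (hζ τ hτI) i).trans (le_of_eq ?_)
      rw [hc]; ring
    have h00 : E 0 ≤ (1 + 2 / b * c) * E 0 := by
      have : 0 ≤ 2 / b * c := by positivity
      nlinarith [hE0 0]
    have hzt := (hz i).mono le_rfl ht.1 ht.2
    have hEt := hE.mono le_rfl ht.1 ht.2
    refine abs_le'.2 ⟨?_, ?_⟩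
    · exact le_mul_of_stable ht.1 hzt hEt hE0 hE' hC0 hcC
        (ae_of_all _ fun τ hτ => (abs_le.1 (hbd τ hτ)).2)
        ((le_abs_self _).trans ((hz0 i).trans h00))
    · have hneg : HasAEDerivOn (fun x => -z i x) (fun x => -z' i x) 0 t := by
        simpa using hzt.const_mul (-1)
      exact le_mul_of_stable ht.1 hneg hEt hE0 hE' hC0 hcC
        (ae_of_all _ fun τ hτ => by linarith [(abs_le.1 (hbd τ hτ)).1])
        ((neg_le_abs _).trans ((hz0 i).trans h00))
  have hzv : ζ ≤ 3 + 4 * n * v := by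
    have h1 : 2 / b * (b * n * v + 2 * n * ζ + 1) = 2 * n * v + 4 * n / b * ζ + 2 / b := by
      field_simp; ring
    have h2 : 4 * n / b ≤ 1 / 2 := by rw [div_le_div_iff₀ hb0 two_pos]; linarith
    have h3 : 2 / b ≤ 1 / 2 := by rw [div_le_div_iff₀ hb0 two_pos]; linarith
    have := mul_le_mul_of_nonneg_right h2 hζ0
    linarith
  have hexp2 : Real.exp (μ * h) ≤ 1 + η / 2 := by
    have h1 : |μ * h| ≤ 1 := by rw [abs_of_nonneg (by positivity)]; linarith
    have h2 := Real.abs_exp_sub_one_le h1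
    rw [abs_of_nonneg (a := μ * h) (by positivity)] at h2
    linarith [(abs_le.1 h2).2]
  set G : ℝ := (2 * n * ζ + 1) / b with hG
  have hG0 : 0 ≤ G := by positivity
  -- For `t ≤ h` compare with time `0`, where the diameter is at most `E 0`; for `t ≥ h` contract
  -- from `t - h`. The right-hand side covers both cases.
  have hvbound : v ≤ Real.exp (μ * h) * ((1 - η) * v + 1 + 2 * h * G) := by
    refine hvmin _ fun t ht k => ?_
    have hdist : ∀ s, 0 ≤ s → t - h ≤ s → ∀ τ ∈ Icc s t, ∀ i,
        |y' i τ - w τ - ∑ j, A τ i j * (y j τ - y i τ)| ≤ G * (Real.exp (μ * h) * E t) := by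
      intro s hs hsh τ hτ i
      have hτI : τ ∈ Icc 0 t₁ := ⟨hs.trans hτ.1, hτ.2.trans ht.2⟩
      have h1 : E τ ≤ Real.exp (μ * h) * E t := (hEexp τ t hτ.2).trans
        (mul_le_mul_of_nonneg_right (Real.exp_le_exp.2
          (mul_le_mul_of_nonneg_left (by linarith [hτ.1]) hμ.le)) (hE0 t).le)
      calc _ ≤ (2 * n * (ζ * E τ) + E τ) / b := hy' τ hτI _ (hζ τ hτI) i
        _ = G * E τ := by rw [hG]; ring
        _ ≤ _ := by gcongr
    have hEt := hE0 t
    rcases le_total t h with hth | hth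
    · have hwt : IntervalIntegrable w volume 0 t := hw.mono_set (by
        rw [uIcc_of_le ht.1, uIcc_of_le ht₁]; exact Icc_subset_Icc le_rfl ht.2)
      have h1 := diam_le ht.1 hA hwt (fun i => (hy i).mono le_rfl ht.1 ht.2)
        (hdist 0 le_rfl (by linarith)) hy0 k.1 k.2
      have h2 : E 0 ≤ Real.exp (μ * h) * E t := (hEexp 0 t ht.1).trans
        (mul_le_mul_of_nonneg_right (Real.exp_le_exp.2
          (mul_le_mul_of_nonneg_left (by linarith) hμ.le)) hEt.le)
      have h3 : 2 * (G * (Real.exp (μ * h) * E t)) * (t - 0) ≤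
          2 * (G * (Real.exp (μ * h) * E t)) * h := by gcongr; linarith
      have h4 : 0 ≤ Real.exp (μ * h) * ((1 - η) * v) * E t := by
        have : 0 ≤ 1 - η := by linarith
        positivity
      linarith
    · have hs : 0 ≤ t - h := by linarith
      have hwt : IntervalIntegrable w volume (t - h) t := hw.mono_set (by
        rw [uIcc_of_le (by linarith), uIcc_of_le ht₁]; exact Icc_subset_Icc hs ht.2)
      have h1 := diam_contraction (V := v * E (t - h)) hT hA hmeas
        (s := t - h) (t := t) (by rw [← hh]; ring)
        (fun τ hτ => htree τ (hs.trans hτ.1)) hwt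
        (fun i => (hy i).mono hs (by linarith) ht.2)
        (hdist (t - h) hs le_rfl) (fun i j => hv (t - h) ⟨hs, by linarith [ht.2]⟩ (i, j)) hδ hd
        k.1 k.2
      rw [← hη] at h1
      have h2 : E (t - h) ≤ Real.exp (μ * h) * E t := by
        simpa using hEexp (t - h) t (by linarith)
      have h3 : (1 - η) * (v * E (t - h)) ≤ (1 - η) * (v * (Real.exp (μ * h) * E t)) := by
        have : 0 ≤ 1 - η := by linarith
        gcongr
      have h4 : 0 ≤ Real.exp (μ * h) * E t := by positivity
      linarith
  -- The loop closes: `v ≤ (1 - η / 2) v + 3 + (η / 4) v`, so `v ≤ 12 / η`.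
  have hvfin : v ≤ 12 / η := by
    have hGb : h * G ≤ η / 16 * v + 1 / 4 := by
      have h1 : h * G ≤ h * ((2 * n * (3 + 4 * n * v) + 1) / b) := by rw [hG]; gcongr
      have h2 : h * ((2 * n * (3 + 4 * n * v) + 1) / b) =
          8 * (h * n ^ 2 / b) * v + 6 * (h * n / b) + h / b := by field_simp; ring
      have h3 : h * n ^ 2 / b ≤ η / 128 := by
        rw [div_le_div_iff₀ hb0 (by norm_num)]; linarith
      have h4 : h * n / b ≤ h * n ^ 2 / b := by gcongr; nlinarith
      have h5 : h / b ≤ h * n ^ 2 / b := by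
        gcongr
        exact le_mul_of_one_le_right hh0.le (by nlinarith)
      have h6 := mul_le_mul_of_nonneg_right h3 hv0
      linarith
    have h1 : Real.exp (μ * h) * (1 - η) ≤ 1 - η / 2 := by
      have := mul_le_mul_of_nonneg_right hexp2 (by linarith : 0 ≤ 1 - η)
      nlinarith
    have h2 := mul_le_mul_of_nonneg_right h1 hv0
    have h3 : Real.exp (μ * h) * (1 + 2 * (h * G)) ≤ 2 * (1 + 2 * (η / 16 * v + 1 / 4)) := by
      gcongr; linarith
    rw [le_div_iff₀ hη0]
    linarith
  intro τ hτ
  refine ⟨fun i j => (hv τ hτ (i, j)).trans ?_, fun i => (hζ τ hτ i).trans ?_⟩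
  · have := (hE0 τ).le
    gcongr
  · have := (hE0 τ).le
    gcongr
    refine hzv.trans ?_
    calc 3 + 4 * n * v ≤ 3 + 4 * n * (12 / η) := by gcongr
      _ = 3 + 48 * n / η := by ring

end SmallGain

end TimeCoordination

namespace TimeCoordination

/-! ### The disagreement matrix `Q` -/

section Disagreement

variable {n : ℕ} {Q : Matrix (Fin (n - 1)) (Fin n) ℝ}

/-- Adding the row `1 / √n` to `Q` gives a square matrix with orthonormal rows, hence an isometry.
-/
theorem sum_sq_mulVec_add (hn : 1 ≤ n) (hQ1 : Q *ᵥ (fun _ => 1) = 0) (hQQ : Q * Qᵀ = 1)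
    (x : Fin n → ℝ) : ∑ k, (Q *ᵥ x) k ^ 2 + (∑ i, x i) ^ 2 / n = ∑ i, x i ^ 2 := by
  have hn0 : (0 : ℝ) < n := by exact_mod_cast hn
  obtain ⟨u, hu⟩ : ∃ u : Matrix Unit (Fin n) ℝ, ∀ i j, u i j = 1 / √n :=
    ⟨fun _ _ => _, fun _ _ => rfl⟩
  obtain ⟨R, hR⟩ : ∃ R : Matrix (Fin (n - 1) ⊕ Unit) (Fin n) ℝ, R = Matrix.fromRows Q u :=
    ⟨_, rfl⟩
  have hQu : Q * uᵀ = 0 := by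
    ext k j
    have := congrFun hQ1 k
    simp only [Matrix.mulVec, dotProduct, mul_one, Pi.zero_apply] at this
    simp only [Matrix.mul_apply, Matrix.transpose_apply, hu, ← Finset.sum_mul, this, zero_mul,
      Matrix.zero_apply]
  have huu : u * uᵀ = 1 := by
    ext i j
    simp only [Matrix.mul_apply, hu, Matrix.transpose_apply, Finset.sum_const, Finset.card_univ,
      Fintype.card_fin, nsmul_eq_mul]
    rw [div_mul_div_comm, Real.mul_self_sqrt hn0.le]
    simp [hn0.ne']
  have huQ : u * Qᵀ = 0 := by
    have := congrArg Matrix.transpose hQu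
    simpa using this
  have hRR : R * Rᵀ = 1 := by
    rw [hR, Matrix.transpose_fromRows, Matrix.fromRows_mul_fromCols, hQQ, hQu, huu, huQ,
      Matrix.fromBlocks_one]
  have hRR' : Rᵀ * R = 1 :=
    (Matrix.mul_eq_one_comm_of_card_eq _ _ _ (by simp; omega)).1 hRR
  have h1 : (R *ᵥ x) ⬝ᵥ (R *ᵥ x) = x ⬝ᵥ x := by
    rw [Matrix.dotProduct_mulVec, ← Matrix.mulVec_transpose, Matrix.mulVec_mulVec, hRR',
      Matrix.one_mulVec]
  rw [hR, Matrix.fromRows_mulVec] at h1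
  simp only [dotProduct, Fintype.sum_sum_type, Sum.elim_inl, Sum.elim_inr] at h1
  have h2 : (u *ᵥ x) () * (u *ᵥ x) () = (∑ i, x i) ^ 2 / n := by
    simp only [Matrix.mulVec, dotProduct, hu, ← Finset.mul_sum]
    rw [mul_mul_mul_comm, div_mul_div_comm, Real.mul_self_sqrt hn0.le]
    ring
  simp only [Finset.univ_unique, Finset.sum_singleton, PUnit.default_eq_unit, h2] at h1
  simpa [sq] using h1

theorem mulVec_sub_const (hQ1 : Q *ᵥ (fun _ => 1) = 0) (x : Fin n → ℝ) (c : ℝ) :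
    Q *ᵥ (fun i => x i - c) = Q *ᵥ x := by
  have : (fun i => x i - c) = x - c • (fun _ : Fin n => (1 : ℝ)) := by ext; simp
  rw [this, Matrix.mulVec_sub, Matrix.mulVec_smul, hQ1]; simp

variable {w : ℝ → ℝ} {γ γ' : ℝ → Fin n → ℝ} {t : ℝ}

theorem norm_coordinationError_sq :
    ‖coordinationError Q w γ γ' t‖ ^ 2 =
      ∑ k, (Q *ᵥ γ t) k ^ 2 + ∑ i, (γ' t i - w t) ^ 2 := by
  simp [coordinationError, EuclideanSpace.norm_sq_eq]

theorem abs_rate_error_le (i : Fin n) :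
    |γ' t i - w t| ≤ ‖coordinationError Q w γ γ' t‖ := by
  refine abs_le_of_sq_le_sq ?_ (norm_nonneg _)
  rw [norm_coordinationError_sq]
  have h1 := Finset.single_le_sum (f := fun i => (γ' t i - w t) ^ 2) (fun i _ => sq_nonneg _)
    (Finset.mem_univ i)
  have h2 : 0 ≤ ∑ k, (Q *ᵥ γ t) k ^ 2 := Finset.sum_nonneg fun _ _ => sq_nonneg _
  linarith

/-- After subtraction of the mean, `Q` preserves the norm, so each deviation from the mean is at
most the error; a difference is two deviations. -/
theorem sub_le_two_mul_norm (hQ1 : Q *ᵥ (fun _ => 1) = 0) (hQQ : Q * Qᵀ = 1) (i j : Fin n) :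
    γ t i - γ t j ≤ 2 * ‖coordinationError Q w γ γ' t‖ := by
  have hn : 1 ≤ n := by have := i.2; omega
  have hn0 : (n : ℝ) ≠ 0 := by positivity
  set c : ℝ := (∑ i, γ t i) / n
  have key : ∀ i, |γ t i - c| ≤ ‖coordinationError Q w γ γ' t‖ := by
    intro i
    refine abs_le_of_sq_le_sq ?_ (norm_nonneg _)
    rw [norm_coordinationError_sq]
    have h1 := Finset.single_le_sum (f := fun i => (γ t i - c) ^ 2) (fun i _ => sq_nonneg _)
      (Finset.mem_univ i)
    have h2 := sum_sq_mulVec_add hn hQ1 hQQ (fun i => γ t i - c)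
    rw [mulVec_sub_const hQ1] at h2
    have h3 : ∑ i, (γ t i - c) = 0 := by
      simp [Finset.sum_sub_distrib, c]; field_simp; simp
    have h4 : 0 ≤ ∑ i, (γ' t i - w t) ^ 2 := Finset.sum_nonneg fun _ _ => sq_nonneg _
    rw [h3] at h2
    simp at h2
    linarith
  have h1 := (abs_le.1 (key i)).2
  have h2 := (abs_le.1 (key j)).1
  linarith

theorem norm_coordinationError_le (hn : 1 ≤ n) (hQ1 : Q *ᵥ (fun _ => 1) = 0) (hQQ : Q * Qᵀ = 1)
    {V Z : ℝ} (hV : ∀ i j, γ t i - γ t j ≤ V) (hZ : ∀ i, |γ' t i - w t| ≤ Z) :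
    ‖coordinationError Q w γ γ' t‖ ≤ n * (V + Z) := by
  have hn' : (1 : ℝ) ≤ n := by exact_mod_cast hn
  let i₀ : Fin n := ⟨0, by omega⟩
  have hV0 : 0 ≤ V := by simpa using hV i₀ i₀
  have hZ0 : 0 ≤ Z := (abs_nonneg _).trans (hZ i₀)
  refine abs_le_of_sq_le_sq' ?_ (by positivity) |>.2
  rw [norm_coordinationError_sq]
  have h2 := sum_sq_mulVec_add hn hQ1 hQQ (fun i => γ t i - γ t i₀)
  rw [mulVec_sub_const hQ1] at h2
  have h3 : ∑ i, (γ t i - γ t i₀) ^ 2 ≤ ∑ _i : Fin n, V ^ 2 :=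
    Finset.sum_le_sum fun i _ => sq_le_sq.2 (by
      rw [abs_of_nonneg hV0]
      exact abs_le.2 ⟨by linarith [hV i₀ i], hV i i₀⟩)
  have h4 : ∑ i, (γ' t i - w t) ^ 2 ≤ ∑ _i : Fin n, Z ^ 2 :=
    Finset.sum_le_sum fun i _ => sq_le_sq.2 (by rw [abs_of_nonneg hZ0]; exact hZ i)
  simp only [Finset.sum_const, Finset.card_univ, Fintype.card_fin, nsmul_eq_mul] at h3 h4
  have h5 : 0 ≤ (∑ i, (γ t i - γ t i₀)) ^ 2 / n := by positivity
  calc _ ≤ n * V ^ 2 + n * Z ^ 2 := by linarith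
    _ ≤ n * (V + Z) ^ 2 := by nlinarith [mul_nonneg hV0 hZ0]
    _ ≤ (n * (V + Z)) ^ 2 := by
      rw [mul_pow]; gcongr; nlinarith

end Disagreement

/-! ### Constants -/

/-- With `x = d ^ n`, `-log(1 - x) ≤ x / (1 - x)` and the factor `(1 - x) ^ 2` from the gain give `μ
≤ x / (6 n² T)`. -/
theorem rate_mul_le {n : ℕ} (hn : 2 ≤ n) {T d μ : ℝ} (hT : 0 < T) (hd0 : 0 < d) (hd1 : d < 1)
    (hμ : μ ≤ -(1 / (n * T)) * Real.log (1 - d ^ n) / (6 * n * (1 / (1 - d ^ n)) ^ 2)) :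
    μ * (((n : ℝ) - 1) * T) ≤ d ^ (n - 1) / 2 / 4 := by
  have hn' : (2 : ℝ) ≤ n := by exact_mod_cast hn
  have hx0 : 0 < d ^ n := by positivity
  have hx1 : d ^ n < 1 := pow_lt_one₀ hd0.le hd1 (by omega)
  have hxle : d ^ n ≤ d ^ (n - 1) := pow_le_pow_of_le_one hd0.le hd1.le (by omega)
  set x := d ^ n
  have h1x : 0 < 1 - x := by linarith
  have hlog : -Real.log (1 - x) ≤ x / (1 - x) := by
    have := Real.one_sub_inv_le_log_of_pos h1x
    have h2 : x / (1 - x) = (1 - x)⁻¹ - 1 := by field_simp; ring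
    linarith
  have h1 : μ ≤ x / (6 * n ^ 2 * T) := by
    calc μ ≤ (-Real.log (1 - x)) * ((1 - x) ^ 2 / (6 * n ^ 2 * T)) := by
          refine hμ.trans (le_of_eq ?_); field_simp
      _ ≤ x / (1 - x) * ((1 - x) ^ 2 / (6 * n ^ 2 * T)) := by gcongr
      _ = (1 - x) * (x / (6 * n ^ 2 * T)) := by field_simp
      _ ≤ 1 * (x / (6 * n ^ 2 * T)) := by gcongr; linarith
      _ = _ := one_mul _
  calc μ * (((n : ℝ) - 1) * T) ≤ x / (6 * n ^ 2 * T) * (n * T) := by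
        have : 0 ≤ (n : ℝ) - 1 := by linarith
        gcongr
        · linarith
    _ = x / (6 * n) := by field_simp
    _ ≤ x / 8 := by gcongr; linarith
    _ ≤ d ^ (n - 1) / 2 / 4 := by linarith

end TimeCoordination

namespace TimeCoordination

/-! ### Solutions of the coordination law -/

theorem HasAEDerivOn.of_hasDerivAt_Ioo {f f' : ℝ → ℝ} {s t : ℝ} (hst : s ≤ t)
    (hf : ContinuousOn f (Icc s t)) (hd : ∀ x ∈ Ioo s t, HasDerivAt f (f' x) x)
    (hi : IntervalIntegrable f' volume s t) : HasAEDerivOn f f' s t := by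
  have h := (HasAEDerivOn.const (f s) s t).add (HasAEDerivOn.of_intervalIntegrable hi)
  simp only [zero_add] at h
  refine h.congr hst fun x hx => ?_
  rw [intervalIntegral.integral_eq_sub_of_hasDerivAt_of_le hx.1
    (hf.mono (Icc_subset_Icc le_rfl hx.2)) (fun y hy => hd y ⟨hy.1, hy.2.trans_le hx.2⟩)
    (hi.mono_set (by
      rw [uIcc_of_le hx.1, uIcc_of_le hst]; exact Icc_subset_Icc le_rfl hx.2))]
  ring

/-- Differentiability alone does not give absolute continuity; the bound makes the measurable
derivative integrable. -/
theorem HasAEDerivOn.of_derivWithin_bounded {w : ℝ → ℝ} {J : Set ℝ} {s t S : ℝ} (hst : s ≤ t)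
    (hJ : Icc s t ⊆ J) (hw : DifferentiableOn ℝ w J) (hS : ∀ x ∈ J, |derivWithin w J x| ≤ S) :
    HasAEDerivOn w (derivWithin w J) s t := by
  have hnhds : ∀ x ∈ Ioo s t, J ∈ nhds x := fun x hx =>
    Filter.mem_of_superset (Icc_mem_nhds hx.1 hx.2) hJ
  have hd : ∀ x ∈ Ioo s t, HasDerivAt w (derivWithin w J x) x := fun x hx =>
    (hw x (hJ (Ioo_subset_Icc_self hx))).hasDerivWithinAt.hasDerivAt (hnhds x hx)
  refine of_hasDerivAt_Ioo hst (hw.continuousOn.mono hJ) hd ?_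
  rw [intervalIntegrable_iff_integrableOn_Ioo_of_le hst]
  have h1 : IntegrableOn (_root_.deriv w) (Ioo s t) volume :=
    Measure.integrableOn_of_bounded (M := S) (by simp) (measurable_deriv w).aestronglyMeasurable
      ((ae_restrict_iff' measurableSet_Ioo).2 (ae_of_all _ fun x hx => by
        rw [(hd x hx).deriv]; exact hS x (hJ (Ioo_subset_Icc_self hx))))
  exact h1.congr_fun (fun x hx => (hd x hx).deriv) measurableSet_Ioo

section Solution

variable {n : ℕ} {a b ε tf : ℝ} {D : ℝ → Digraph (Fin n)}
  {pd p : Fin n → ℝ → EuclideanSpace ℝ (Fin 3)} {w : ℝ → ℝ} {J : Set ℝ} {γ γ' : ℝ → Fin n → ℝ}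
  {t T δ : ℝ}

theorem adjMatrix_mem_Icc (D : Digraph (Fin n)) (i j : Fin n) :
    adjMatrix D i j ∈ Icc (0 : ℝ) 1 := by
  unfold adjMatrix; split_ifs <;> simp

theorem measurable_adjMatrix (hD : MeasurableDigraph D) (i j : Fin n) :
    Measurable fun τ => adjMatrix (D τ) i j := by
  classical
  exact Measurable.ite (hD i j) measurable_const measurable_const

theorem sum_neighborhood (D : Digraph (Fin n)) (i : Fin n) (f : Fin n → ℝ) :
    ∑ j ∈ neighborhood D i, f j = ∑ j, adjMatrix D i j * f j := by
  simp [neighborhood, adjMatrix, Finset.sum_filter]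

/-- Off the diagonal `-L` is the adjacency matrix. The guard `j ≠ i` makes loops free, which does
not affect reachability. -/
theorem HasDeltaSpanningTree.weighted (h : HasDeltaSpanningTree D t T δ) :
    HasWeightedSpanningTree (fun τ => adjMatrix (D τ)) t T δ := by
  obtain ⟨r, hr⟩ := h
  refine ⟨r, fun i => Relation.ReflTransGen.mono (fun j i hji hne => ?_) _ _ (hr i)⟩
  have : ∀ τ, -(laplacian (D τ) i j) = adjMatrix (D τ) i j := fun τ => by
    simp [laplacian, Matrix.diagonal_apply_ne' _ hne]
  simpa [IsDeltaEdge, this] using hji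

theorem abs_alphaBar_le (hε : 0 < ε) (i : Fin n) :
    |alphaBar ε tf pd p γ i t| ≤ ‖pathError pd p γ t‖ := by
  unfold alphaBar
  set u := desiredVelocity tf pd i (γ t i)
  have hu : 0 < ‖u‖ + ε := by positivity
  rw [abs_div, abs_of_pos hu, div_le_iff₀ hu]
  have h1 := abs_real_inner_le_norm u (pathError pd p γ t i)
  have h2 : ‖pathError pd p γ t i‖ ≤ ‖pathError pd p γ t‖ := PiLp.norm_apply_le _ i
  have h3 := norm_nonneg u
  have h4 := norm_nonneg (pathError pd p γ t i)
  calc _ ≤ ‖u‖ * ‖pathError pd p γ t i‖ := h1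
    _ ≤ (‖u‖ + ε) * ‖pathError pd p γ t‖ := by gcongr; linarith
    _ = _ := mul_comm _ _

theorem IsCoordinationSolution.hasAEDerivOn_rate
    (h : IsCoordinationSolution a b ε tf D pd p w J γ γ') (ht : 0 ≤ t) (hJ : Icc 0 t ⊆ J)
    (i : Fin n) :
    HasAEDerivOn (fun s => γ' s i) (coordinationLaw a b ε tf D pd p w γ γ' i) 0 t := by
  have h1 := (HasAEDerivOn.const (γ' 0 i) 0 t).add
    (HasAEDerivOn.of_intervalIntegrable (h.integrable t (hJ (right_mem_Icc.2 ht)) i))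
  simp only [zero_add] at h1
  exact h1.congr ht fun x hx => h.rate_eq x (hJ hx) i

theorem IsCoordinationSolution.hasAEDerivOn
    (h : IsCoordinationSolution a b ε tf D pd p w J γ γ') (ht : 0 ≤ t) (hJ : Icc 0 t ⊆ J)
    (i : Fin n) : HasAEDerivOn (fun s => γ s i) (fun s => γ' s i) 0 t := by
  refine .of_hasDerivAt_Ioo ht
    (fun x hx => ((h.hasDeriv x (hJ hx) i).continuousWithinAt).mono hJ)
    (fun x hx => (h.hasDeriv x (hJ (Ioo_subset_Icc_self hx)) i).hasDerivAt
      (Filter.mem_of_superset (Icc_mem_nhds hx.1 hx.2) hJ)) ?_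
  refine ContinuousOn.intervalIntegrable ?_
  rw [uIcc_of_le ht]
  exact (h.hasAEDerivOn_rate ht hJ i).continuousOn ht

theorem abs_sum_mul_le {a x : Fin n → ℝ} {B : ℝ} (ha : ∀ j, a j ∈ Icc (0 : ℝ) 1)
    (hx : ∀ j, |x j| ≤ B) : |∑ j, a j * x j| ≤ n * B := by
  refine (Finset.abs_sum_le_sum_abs _ _).trans ?_
  have : ∑ j, |a j * x j| ≤ ∑ _j : Fin n, B := Finset.sum_le_sum fun j _ => by
    rw [abs_mul, abs_of_nonneg (ha j).1]
    exact (mul_le_of_le_one_left (abs_nonneg _) (ha j).2).trans (hx j)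
  simpa using this

/-- Exponential bound for the coordination error, for equal gains `a = b` large enough. -/
theorem IsCoordinationSolution.norm_coordinationError_le {d η h μ S N : ℝ}
    {Q : Matrix (Fin (n - 1)) (Fin n) ℝ}
    (hsol : IsCoordinationSolution b b ε tf D pd p w J γ γ')
    (hn : 2 ≤ n) (hT : 0 < T) (hδ : 0 ≤ δ) (hε : 0 < ε)
    (hd : d = min 1 δ * Real.exp (-((n : ℝ) - 1) * T)) (hη : η = d ^ (n - 1) / 2) (hη0 : 0 < η)
    (hh : h = ((n : ℝ) - 1) * T) (hμ : 0 < μ) (hμh : μ * h ≤ η / 4)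
    (hb1 : 8 * n ≤ b) (hb2 : 2 * μ ≤ b) (hb3 : 128 * h * n ^ 2 ≤ η * b)
    (hD : MeasurableDigraph D) (htree : ∀ t, 0 ≤ t → HasDeltaSpanningTree D t T δ)
    (hQ1 : Q *ᵥ (fun _ => 1) = 0) (hQQ : Q * Qᵀ = 1) (ht : 0 ≤ t) (hJ : Icc 0 t ⊆ J)
    (hw : DifferentiableOn ℝ w J)
    (hS : ∀ s ∈ J, ‖pathError pd p γ s‖ + |derivWithin w J s| ≤ S)
    (hN : ‖coordinationError Q w γ γ' 0‖ < N) :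
    ‖coordinationError Q w γ γ' t‖ ≤
      n * (12 / η + 3 * (3 + 48 * n / η)) * (4 * N * Real.exp (-μ * t) + S) := by
  have hn' : (2 : ℝ) ≤ n := by exact_mod_cast hn
  have hb0 : 0 < b := by linarith
  have hN0 : 0 < N := (norm_nonneg _).trans_lt hN
  have hS0 : 0 ≤ S := by
    have := hS 0 (hJ (left_mem_Icc.2 ht)); refine le_trans ?_ this; positivity
  have hwJ : ∀ s ∈ J, |derivWithin w J s| ≤ S := fun s hs =>
    le_trans (le_add_of_nonneg_left (norm_nonneg _)) (hS s hs)
  have hwd := HasAEDerivOn.of_derivWithin_bounded ht hJ hw hwJ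
  have hγ := hsol.hasAEDerivOn ht hJ
  have hγ' := hsol.hasAEDerivOn_rate ht hJ
  set law := coordinationLaw b b ε tf D pd p w γ γ' with hlaw
  have hlaw_eq : ∀ i τ, law i τ = -b * (γ' τ i - w τ) +
      b * ∑ j, adjMatrix (D τ) i j * (γ τ j - γ τ i) + alphaBar ε tf pd p γ i τ := by
    intro i τ
    rw [hlaw, coordinationLaw, sum_neighborhood]
    have : ∑ j, adjMatrix (D τ) i j * (γ τ i - γ τ j) =
        -∑ j, adjMatrix (D τ) i j * (γ τ j - γ τ i) := by
      rw [← Finset.sum_neg_distrib]; exact Finset.sum_congr rfl fun j _ => by ring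
    rw [this]; ring
  -- The factor `4` covers the initial diameter of `y`: `2 N` from `γ` and `2 N / b ≤ 2 N` from the
  -- rates. The strict bound by `N` keeps `E` positive even if `S = 0`.
  set E : ℝ → ℝ := fun τ => 4 * N * Real.exp (-μ * τ) + S with hEdef
  have hE0 : ∀ τ, 0 < E τ := fun τ => by positivity
  have hSE : ∀ τ, S ≤ E τ := fun τ => le_add_of_nonneg_left (by positivity)
  have hEd : HasAEDerivOn E (fun τ => -μ * (4 * N * Real.exp (-μ * τ))) 0 t := by
    have h1 : ∀ τ, HasDerivAt E (-μ * (4 * N * Real.exp (-μ * τ))) τ := fun τ => by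
      have := ((((hasDerivAt_id τ).const_mul (-μ)).exp).const_mul (4 * N)).add_const S
      convert! this using 1
      simp; ring
    have h2 := HasAEDerivOn.of_contDiff (f := E) (by fun_prop) 0 t
    exact ⟨h2.ac, ae_of_all _ fun τ _ => h1 τ⟩
  have hx1 : ∀ τ i j (c : ℝ), (γ τ j + c * γ' τ j) - (γ τ i + c * γ' τ i) =
      (γ τ j - γ τ i) + c * ((γ' τ j - w τ) - (γ' τ i - w τ)) := fun τ i j c => by ring
  have hsplit : ∀ τ i, ∑ j, adjMatrix (D τ) i j *
        ((γ τ j + b⁻¹ * γ' τ j) - (γ τ i + b⁻¹ * γ' τ i)) =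
      ∑ j, adjMatrix (D τ) i j * (γ τ j - γ τ i) +
        b⁻¹ * ∑ j, adjMatrix (D τ) i j * ((γ' τ j - w τ) - (γ' τ i - w τ)) := fun τ i => by
    rw [Finset.mul_sum, ← Finset.sum_add_distrib]
    exact Finset.sum_congr rfl fun j _ => by ring
  have hzdiff : ∀ τ Z, (∀ i, |γ' τ i - w τ| ≤ Z) → ∀ i j,
      |(γ' τ j - w τ) - (γ' τ i - w τ)| ≤ 2 * Z := fun τ Z hZ i j =>
    (abs_sub _ _).trans (by linarith [hZ i, hZ j])
  have hαw : ∀ τ ∈ Icc 0 t, ∀ i, |alphaBar ε tf pd p γ i τ| + |derivWithin w J τ| ≤ S :=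
    fun τ hτ i => (add_le_add_left (abs_alphaBar_le hε i) _).trans (hS τ (hJ hτ))
  have key := small_gain (A := fun τ => adjMatrix (D τ)) (w := w) (E := E)
    (y := fun i τ => γ τ i + b⁻¹ * γ' τ i) (y' := fun i τ => γ' τ i + b⁻¹ * law i τ)
    (z := fun i τ => γ' τ i - w τ) (z' := fun i τ => law i τ - derivWithin w J τ)
    hn hT hδ hd hη hη0 hh hμ hμh hb1 hb2 hb3 ht
    (fun τ i j => adjMatrix_mem_Icc (D τ) i j) (measurable_adjMatrix hD)
    (fun τ hτ => (htree τ hτ).weighted)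
    (by
      refine ContinuousOn.intervalIntegrable ?_
      rw [uIcc_of_le ht]; exact hwd.continuousOn ht)
    hEd hE0
    (fun τ => by simp only [hEdef]; nlinarith)
    (fun σ τ hστ => by
      have h1 : Real.exp (μ * (τ - σ)) * E τ =
          4 * N * Real.exp (-μ * σ) + Real.exp (μ * (τ - σ)) * S := by
        simp only [hEdef]
        have : Real.exp (-μ * σ) = Real.exp (μ * (τ - σ)) * Real.exp (-μ * τ) := by
          rw [← Real.exp_add]; congr 1; ring
        rw [this]; ring
      rw [h1]
      have h2 : 1 ≤ Real.exp (μ * (τ - σ)) :=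
        Real.one_le_exp (mul_nonneg hμ.le (by linarith))
      simp only [hEdef]
      nlinarith)
    (fun i => (hγ i).add ((hγ' i).const_mul _))
    (fun τ hτ Z hZ i => by
      rw [hsplit, hlaw_eq]
      have h1 := abs_sum_mul_le (fun j => adjMatrix_mem_Icc (D τ) i j)
        (hzdiff τ Z hZ i)
      have h2 : |alphaBar ε tf pd p γ i τ| ≤ E τ := by
        linarith [hαw τ hτ i, abs_nonneg (derivWithin w J τ), hSE τ]
      set P := ∑ j, adjMatrix (D τ) i j * (γ τ j - γ τ i)
      set R := ∑ j, adjMatrix (D τ) i j * ((γ' τ j - w τ) - (γ' τ i - w τ))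
      -- The damping term cancels `γ'` up to `w`, leaving a disturbance divided by `b`.
      have h3 : γ' τ i + b⁻¹ * (-b * (γ' τ i - w τ) + b * P + alphaBar ε tf pd p γ i τ) - w τ -
          (P + b⁻¹ * R) = (alphaBar ε tf pd p γ i τ - R) / b := by
        field_simp; ring
      rw [h3, abs_div, abs_of_pos hb0]
      gcongr
      refine (abs_sub _ _).trans ?_
      linarith)
    (fun i => (hγ' i).sub hwd)
    (fun τ hτ V Z hV hZ i => by
      have hτI := Ioo_subset_Icc_self hτ
      have h0 := hsplit τ i
      have h1 := abs_sum_mul_le (fun j => adjMatrix_mem_Icc (D τ) i j)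
        (hzdiff τ Z hZ i)
      have h2 := abs_sum_mul_le (fun j => adjMatrix_mem_Icc (D τ) i j)
        (x := fun j => (γ τ j + b⁻¹ * γ' τ j) - (γ τ i + b⁻¹ * γ' τ i))
        (fun j => abs_le.2 ⟨by linarith [hV i j], hV j i⟩)
      rw [hlaw_eq]
      set P := ∑ j, adjMatrix (D τ) i j * (γ τ j - γ τ i)
      set R := ∑ j, adjMatrix (D τ) i j * ((γ' τ j - w τ) - (γ' τ i - w τ))
      have h3 : -b * (γ' τ i - w τ) + b * P + alphaBar ε tf pd p γ i τ - derivWithin w J τ +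
          b * (γ' τ i - w τ) = b * (P + b⁻¹ * R) - R + alphaBar ε tf pd p γ i τ -
            derivWithin w J τ := by field_simp; ring
      rw [h3]
      simp only [h0] at h2
      have h4 := mul_le_mul_of_nonneg_left h2 hb0.le
      rw [← abs_of_pos hb0, ← abs_mul, abs_of_pos hb0] at h4
      have h5 := hαw τ hτI i
      have h6 := hSE τ
      have h7 := abs_sub (b * (P + b⁻¹ * R) - R + alphaBar ε tf pd p γ i τ) (derivWithin w J τ)
      have h8 := abs_add_le (b * (P + b⁻¹ * R) - R) (alphaBar ε tf pd p γ i τ)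
      have h9 := abs_sub (b * (P + b⁻¹ * R)) R
      linarith)
    (fun i j => by
      rw [hx1]
      have h1 := sub_le_two_mul_norm (w := w) (γ := γ) (γ' := γ') (t := 0) hQ1 hQQ i j
      have h2 := hzdiff 0 _ (abs_rate_error_le (Q := Q) (γ := γ)) j i
      have h3 : b⁻¹ ≤ 1 := inv_le_one_of_one_le₀ (by linarith)
      have h4 : b⁻¹ * ((γ' 0 i - w 0) - (γ' 0 j - w 0)) ≤
          1 * (2 * ‖coordinationError Q w γ γ' 0‖) :=
        (mul_le_mul_of_nonneg_left ((le_abs_self _).trans h2) (by positivity)).trans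
          (by gcongr)
      simp only [hEdef, mul_zero, Real.exp_zero, mul_one]
      linarith)
    (fun i => by
      have := abs_rate_error_le (Q := Q) (γ := γ) (γ' := γ') (w := w) (t := 0) i
      simp only [hEdef, mul_zero, Real.exp_zero, mul_one]
      linarith)
  obtain ⟨hV, hZ⟩ := key t (right_mem_Icc.2 ht)
  have hEt := (hE0 t).le
  have hVγ : ∀ i j, γ t i - γ t j ≤ (12 / η + 2 * (3 + 48 * n / η)) * E t := fun i j => by
    have h1 := hV i j
    rw [hx1] at h1
    have h2 := (neg_le_abs _).trans (hzdiff t _ hZ j i)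
    have h3 : b⁻¹ ≤ 1 := inv_le_one_of_one_le₀ (by linarith)
    have h4 : b⁻¹ * -((γ' t i - w t) - (γ' t j - w t)) ≤ 1 * (2 * ((3 + 48 * n / η) * E t)) :=
      (mul_le_mul_of_nonneg_left h2 (by positivity)).trans (by gcongr)
    linarith
  refine (TimeCoordination.norm_coordinationError_le (by omega) hQ1 hQQ hVγ hZ).trans (le_of_eq ?_)
  simp only [hEdef]; ring

end Solution

end TimeCoordination

/-! ### Choice of the gains and conclusion -/

theorem theorem1 (n : ℕ) (hn : 2 ≤ n) (T δ : ℝ) (hT : 0 < T) (hδ : 0 < δ) :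
    ∃ a b ε : ℝ, 0 < a ∧ 0 < b ∧ 0 < ε ∧
      ∀ lamTC : ℝ, 0 < lamTC →
        lamTC ≤ TimeCoordination.consensusRate n a b T δ /
          (6 * n * TimeCoordination.consensusGain n a b T δ ^ 2) →
        ∃ κ₁ κ₂ : ℝ, 0 < κ₁ ∧ 0 < κ₂ ∧
          ∀ (D : ℝ → Digraph (Fin n)) (Q : Matrix (Fin (n - 1)) (Fin n) ℝ) (tf : ℝ)
            (pd p : Fin n → ℝ → EuclideanSpace ℝ (Fin 3)) (J : Set ℝ) (w : ℝ → ℝ)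
            (γ γ' : ℝ → Fin n → ℝ),
            TimeCoordination.MeasurableDigraph D →
            (∀ t : ℝ, 0 ≤ t → TimeCoordination.HasDeltaSpanningTree D t T δ) →
            Q *ᵥ (fun _ => 1) = 0 →
            Q * Qᵀ = 1 →
            0 < tf →
            (∀ i, DifferentiableOn ℝ (pd i) (Set.Icc 0 tf)) →
            J.OrdConnected →
            0 ∈ J →
            J ⊆ Set.Ici 0 →
            DifferentiableOn ℝ w J →
            TimeCoordination.IsCoordinationSolution a b ε tf D pd p w J γ γ' →
            ∀ t ∈ J,
              ENNReal.ofReal ‖TimeCoordination.coordinationError Q w γ γ' t‖ ≤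
                ENNReal.ofReal
                    (κ₁ * ‖TimeCoordination.coordinationError Q w γ γ' 0‖ * Real.exp (-lamTC * t))
                  + ENNReal.ofReal κ₂ *
                    ⨆ s ∈ J, ENNReal.ofReal
                      (‖TimeCoordination.pathError pd p γ s‖ + |derivWithin w J s|) := by
  have hn' : (2 : ℝ) ≤ n := by exact_mod_cast hn
  set d : ℝ := min 1 δ * Real.exp (-((n : ℝ) - 1) * T) with hd
  set η : ℝ := d ^ (n - 1) / 2 with hη
  set h : ℝ := ((n : ℝ) - 1) * T with hh
  have hh0 : 0 < h := mul_pos (by linarith) hT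
  have hd0 : 0 < d := mul_pos (lt_min one_pos hδ) (Real.exp_pos _)
  have hd1 : d < 1 := by
    have h1 : Real.exp (-((n : ℝ) - 1) * T) < 1 := Real.exp_lt_one_iff.2 (by linarith)
    calc d ≤ 1 * Real.exp (-((n : ℝ) - 1) * T) := by rw [hd]; gcongr; exact min_le_left _ _
      _ < 1 := by rwa [one_mul]
  have hη0 : 0 < η := by positivity
  have hη1 : η ≤ 1 := by
    have : d ^ (n - 1) ≤ 1 := pow_le_one₀ hd0.le hd1.le
    linarith
  -- One summand for each requirement of `small_gain`. As `μ h ≤ η / 4 ≤ 1 / 4`, the summand `1 / h`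
  -- dominates `2 μ` for every admissible rate.
  set b : ℝ := 128 * h * n ^ 2 / η + 8 * n + 1 / h with hb
  have hb0 : 0 < b := by positivity
  have hdelta : TimeCoordination.deltaPrime n b b T δ = d := by
    rw [TimeCoordination.deltaPrime, div_self hb0.ne', hd, one_mul, mul_one]
  refine ⟨b, b, 1, hb0, hb0, one_pos, fun μ hμ hμle => ?_⟩
  rw [TimeCoordination.consensusRate, TimeCoordination.consensusGain, hdelta] at hμle
  have hμh : μ * h ≤ η / 4 := TimeCoordination.rate_mul_le hn hT hd0 hd1 hμle
  have hb1 : 8 * n ≤ b := by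
    have h1 : 0 ≤ 128 * h * n ^ 2 / η := by positivity
    have h2 : 0 ≤ 1 / h := by positivity
    linarith
  have hb2 : 2 * μ ≤ b := by
    have h1 : 2 * μ ≤ 1 / h := by rw [le_div_iff₀ hh0]; linarith
    have h2 : 0 ≤ 128 * h * n ^ 2 / η + 8 * n := by positivity
    linarith
  have hb3 : 128 * h * n ^ 2 ≤ η * b := by
    have h1 : η * b = 128 * h * n ^ 2 + η * (8 * n + 1 / h) := by rw [hb]; field_simp; ring
    have h2 : 0 ≤ η * (8 * n + 1 / h) := by positivity
    linarith
  set K : ℝ := n * (12 / η + 3 * (3 + 48 * n / η)) with hK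
  have hK0 : 0 < K := by positivity
  refine ⟨K * 4, K, by positivity, hK0, ?_⟩
  intro D Q tf pd p J w γ γ' hD htree hQ1 hQQ _ _ hJc h0J hJ0 hw hsol t htJ
  have hJ : Set.Icc 0 t ⊆ J := hJc.out h0J htJ
  rcases eq_or_ne (⨆ s ∈ J, ENNReal.ofReal
      (‖TimeCoordination.pathError pd p γ s‖ + |derivWithin w J s|)) ⊤ with htop | htop
  · rw [htop, ENNReal.mul_top (by simpa using hK0)]
    simp
  set S := ⨆ s ∈ J, ENNReal.ofReal
      (‖TimeCoordination.pathError pd p γ s‖ + |derivWithin w J s|) with hSdef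
  have hS : ∀ s ∈ J, ‖TimeCoordination.pathError pd p γ s‖ + |derivWithin w J s| ≤ S.toReal :=
    fun s hs => (ENNReal.ofReal_le_iff_le_toReal htop).1 (by
      rw [hSdef]
      exact le_iSup₂ (f := fun s (_ : s ∈ J) => ENNReal.ofReal
        (‖TimeCoordination.pathError pd p γ s‖ + |derivWithin w J s|)) s hs)
  rw [← ENNReal.ofReal_toReal htop, ← ENNReal.ofReal_mul hK0.le,
    ← ENNReal.ofReal_add (by positivity) (by positivity)]
  refine ENNReal.ofReal_le_ofReal ?_
  set N := ‖TimeCoordination.coordinationError Q w γ γ' 0‖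
  have hc : 0 < K * 4 * Real.exp (-μ * t) := by positivity
  -- The bound needs a number strictly above the initial error; the excess is scaled to contribute
  -- exactly `e` at time `t`.
  refine le_of_forall_pos_le_add fun e he => ?_
  have := hsol.norm_coordinationError_le (N := N + e / (K * 4 * Real.exp (-μ * t))) hn hT hδ.le
    one_pos hd hη hη0 hh hμ hμh hb1 hb2 hb3 hD htree hQ1 hQQ (hJ0 htJ) hJ hw hS
    (lt_add_of_pos_right _ (by positivity))
  refine this.trans (le_of_eq ?_)
  have h1 : K * 4 * Real.exp (-μ * t) * (e / (K * 4 * Real.exp (-μ * t))) = e :=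
    mul_div_cancel₀ _ hc.ne'
  linear_combination h1
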